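/- Let $\mathbb D=\{|z|<1\}$ and let $U\subseteq\mathbb C$ be a simply connected open set containing $0$. Let $f$ be any univalent (injective holomorphic) map of $\mathbb D$ onto $U$ with $f(0)=0$; the quantities below do not depend on the choice of $f$. Skorokhod energy: for a real $2\pi$-periodic function $u$, put $\mathfrak E(u)=\frac12\cdot\frac1{2\pi}\int_0^{2\pi}|u'(t)|^2\,dt$ if $u$ is integrable on $(0,2\pi)$ and its distributional derivative $u'$ (on the circle) is a square-integrable function, and $\mathfrak E(u)=\infty$ otherwise. Then $\Lambda(U)=\mathfrak E(\Re f(e^{it}))$, where $\Re f(e^{it})$ denotes the $2\pi$-periodic function that is for almost every $t$ the radial limit $\lim_{r\to1^-}\Re f(re^{it})$ and is also the limit of $\Re f(re^{it})$ in $L^1(0,2\pi)$ as $r\to1^-$; if there is no such function, $\Lambda(U)=\infty$. Perimeter: $\ell(U)=2\pi H_1(f')$, where $H_1(f')=\sup_{0\le r<1}\frac1{2\pi}\int_0^{2\pi}|f'(re^{i\theta})|\,d\theta\in[0,\infty]$. (If $U=\mathbb C$, where no such $f$ exists, put $\Lambda(U)=\ell(U)=\infty$.) A domain of finite Skorokhod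 energy has finite perimeter and finite area: if $\Lambda(U)<\infty$, then $\ell(U)<\infty$, $\mathrm{area}(U)<\infty$, and the topological boundary has finite length, $\mathcal H^1(\partial U)\le\ell(U)$, where $\mathcal H^1$ is the one-dimensional Hausdorff measure. More precisely, in $[0,\infty]$, $$\mathrm{area}(U)\le\frac{\ell(U)^2}{4\pi}\le4\pi\Lambda(U),\qquad\text{in particular}\qquad \mathrm{area}(U)\le4\pi\Lambda(U).$$ -/

import Mathlib

open MeasureTheory Set Filter Metric
open scoped ENNReal Topology ContDiff

noncomputable section

/-- `f` is a univalent (injective holomorphic) map of the open unit disc onto `U` fixing the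
origin. Only the values of `f` on the open unit disc matter. -/
structure IsUnivalentOnto (f : ℂ → ℂ) (U : Set ℂ) : Prop where
  differentiableOn : DifferentiableOn ℂ f (ball 0 1)
  injOn : InjOn f (ball 0 1)
  image_eq : f '' ball 0 1 = U
  map_zero : f 0 = 0

/-- The Hardy norm `H_p(F) = sup_{0 ≤ r < 1} ((1/2π) ∫_0^{2π} |F(r e^{iθ})|^p dθ)^{1/p}`,
with values in `[0, ∞]`. Recall `circleMap 0 r θ = r e^{iθ}`. -/
def hardyNorm (p : ℝ) (F : ℂ → ℂ) : ℝ≥0∞ :=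
  ⨆ r ∈ Ico (0 : ℝ) 1,
    ((ENNReal.ofReal (2 * Real.pi))⁻¹ *
      ∫⁻ θ in Ioc 0 (2 * Real.pi), ‖F (circleMap 0 r θ)‖ₑ ^ p) ^ (1 / p)

/-- `v` is the distributional derivative of the `2π`-periodic function `u` on the circle
(`u`, `v` locally integrable and `2π`-periodic, tested against smooth `2π`-periodic functions). -/
structure IsPeriodicWeakDeriv (u v : ℝ → ℝ) : Prop where
  periodic : Function.Periodic u (2 * Real.pi)
  periodic_deriv : Function.Periodic v (2 * Real.pi)
  intervalIntegrable : IntervalIntegrable u volume 0 (2 * Real.pi)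
  intervalIntegrable_deriv : IntervalIntegrable v volume 0 (2 * Real.pi)
  integral_eq : ∀ φ : ℝ → ℝ, ContDiff ℝ ∞ φ → Function.Periodic φ (2 * Real.pi) →
    ∫ t in (0 : ℝ)..(2 * Real.pi), u t * deriv φ t = -∫ t in (0 : ℝ)..(2 * Real.pi), v t * φ t

/-- The kinetic energy `𝔈(u) = (1/2) (1/2π) ∫_0^{2π} |u'|²` of a real `2π`-periodic function,
`u'` being the distributional derivative (unique almost everywhere); it is `∞` when `u'` is not
a function or is not square integrable. -/
def kineticEnergy (u : ℝ → ℝ) : ℝ≥0∞ :=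
  ⨅ (v : ℝ → ℝ) (_ : IsPeriodicWeakDeriv u v),
    (1 / 2) * ((ENNReal.ofReal (2 * Real.pi))⁻¹ *
      ∫⁻ t in Ioc 0 (2 * Real.pi), ‖v t‖ₑ ^ 2)

/-- `u(t)` is the boundary function `Re f(e^{it})`: it is the radial limit of `Re f` at almost every
`e^{it}`, and it is also the limit of `t ↦ Re f(r e^{it})` in `L¹(0, 2π)`. The latter holds
automatically for the radial limits of an `f` in the Hardy space `H¹`; it is what makes the
Fourier coefficients of `u` those of `f`. (Without it, `2z/(1-z)`, which maps the
disc onto the half-plane `Re > -1`, would have the constant boundary function `-1`.) -/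
structure IsBoundaryRealPart (f : ℂ → ℂ) (u : ℝ → ℝ) : Prop where
  periodic : Function.Periodic u (2 * Real.pi)
  radial_limit : ∀ᵐ t : ℝ, Tendsto (fun r : ℝ => (f (circleMap 0 r t)).re) (𝓝[<] 1) (𝓝 (u t))
  tendsto_L1 : Tendsto
    (fun r : ℝ => ∫⁻ t in Ioc 0 (2 * Real.pi), ‖(f (circleMap 0 r t)).re - u t‖ₑ)
    (𝓝[<] 1) (𝓝 0)

/-- The energy `𝔈(Re f(e^{it}))` of a map defined on the unit disc, `∞` if there is no boundary
function (which is unique almost everywhere). -/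
def mapEnergy (f : ℂ → ℂ) : ℝ≥0∞ :=
  ⨅ (u : ℝ → ℝ) (_ : IsBoundaryRealPart f u), kineticEnergy u

/-- The length `2π H₁(f')` of the boundary of the image of the disc under a univalent map `f`. -/
def mapPerimeter (f : ℂ → ℂ) : ℝ≥0∞ :=
  ENNReal.ofReal (2 * Real.pi) * hardyNorm 1 (deriv f)

/-- The Skorokhod energy `Λ(U)`: the energy `𝔈(Re f(e^{it}))`, where `f` is any univalent map of
the unit disc onto `U` fixing the origin. It does not depend on `f`, see `skorokhodEnergy_eq`; it is
`∞` if there is no such map, e.g. for the whole plane. -/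
def skorokhodEnergy (U : Set ℂ) : ℝ≥0∞ :=
  ⨅ (f : ℂ → ℂ) (_ : IsUnivalentOnto f U), mapEnergy f

/-- The perimeter `ℓ(U) = 2π H₁(f')`, where `f` is any univalent map of the unit disc onto `U`
fixing the origin. It does not depend on `f`, see `domainPerimeter_eq`; it is `∞` if there is no
such map, e.g. for the whole plane. -/
def domainPerimeter (U : Set ℂ) : ℝ≥0∞ :=
  ⨅ (f : ℂ → ℂ) (_ : IsUnivalentOnto f U), mapPerimeter f

end

/-! ### Independence of the choice of the univalent map -/

theorem IsUnivalentOnto.exists_transition {f g : ℂ → ℂ} {U : Set ℂ}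
    (hf : IsUnivalentOnto f U) (hg : IsUnivalentOnto g U) :
    ∃ h : ℂ → ℂ, DifferentiableOn ℂ h (ball 0 1) ∧ MapsTo h (ball 0 1) (ball 0 1) ∧ h 0 = 0 ∧
      ∀ z ∈ ball (0 : ℂ) 1, g (h z) = f z := by
  set D : Set ℂ := ball 0 1 with hD
  have hDo : IsOpen D := isOpen_ball
  have hDc : IsPreconnected D := (convex_ball (0 : ℂ) 1).isPreconnected
  have h0D : (0 : ℂ) ∈ D := by simp [hD]
  have hga : AnalyticOnNhd ℂ g D := hg.differentiableOn.analyticOnNhd hDo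
  have hhalf : (1 / 2 : ℂ) ∈ D := by simp [hD]; norm_num
  have hopen : ∀ s ⊆ D, IsOpen s → IsOpen (g '' s) := by
    rcases hga.is_constant_or_isOpen hDc with ⟨w, hw⟩ | h
    · exfalso
      have := hg.injOn h0D hhalf (by rw [hw 0 h0D, hw _ hhalf])
      norm_num at this
    · exact h
  have hUo : IsOpen U := by rw [← hg.image_eq]; exact hopen D subset_rfl hDo
  set G := Function.invFunOn g D with hG
  have hGm : ∀ w ∈ U, G w ∈ D := fun w hw =>
    Function.invFunOn_mem (by rw [← hg.image_eq] at hw; exact hw)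
  have hgG : ∀ w ∈ U, g (G w) = w := fun w hw =>
    Function.invFunOn_eq (by rw [← hg.image_eq] at hw; exact hw)
  have hGg : ∀ z ∈ D, G (g z) = z := fun z hz => by
    have hz' : g z ∈ U := by rw [← hg.image_eq]; exact mem_image_of_mem g hz
    exact hg.injOn (hGm _ hz') hz (hgG _ hz')
  have hGc : ∀ w ∈ U, ContinuousAt G w := by
    intro w hw
    rw [ContinuousAt, tendsto_def]
    intro V hV
    obtain ⟨V', hV'V, hV'o, hV'm⟩ := _root_.mem_nhds_iff.1 hV
    have h1 : IsOpen (g '' (V' ∩ D)) := hopen _ inter_subset_right (hV'o.inter hDo)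
    refine mem_of_superset (h1.mem_nhds ⟨G w, ⟨hV'm, hGm w hw⟩, hgG w hw⟩) ?_
    rintro _ ⟨z, ⟨hz1, hz2⟩, rfl⟩
    simpa [hGg z hz2] using hV'V hz1
  have hGreg : ∀ w ∈ U, deriv g (G w) ≠ 0 → DifferentiableAt ℂ G w := by
    intro w hw hne
    refine (HasDerivAt.of_local_left_inverse (hGc w hw)
      ((hg.differentiableOn.differentiableAt (hDo.mem_nhds (hGm w hw))).hasDerivAt) hne ?_
      ).differentiableAt
    filter_upwards [hUo.mem_nhds hw] with y hy using hgG y hy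
  have hGd : ∀ w ∈ U, DifferentiableAt ℂ G w := by
    intro w hw
    have hev : ∀ᶠ z in 𝓝[≠] (G w), deriv g z ≠ 0 := by
      by_contra hcon
      have hz : EqOn (deriv g) 0 D :=
        hga.deriv.eqOn_zero_of_preconnected_of_frequently_eq_zero hDc (hGm w hw)
          (fun hc => hcon (by simpa using hc))
      have hconst := hDo.is_const_of_deriv_eq_zero hDc hg.differentiableOn hz h0D hhalf
      have := hg.injOn h0D hhalf hconst
      norm_num at this
    have htend : Tendsto G (𝓝[≠] w) (𝓝[≠] (G w)) := by
      refine tendsto_nhdsWithin_iff.2 ⟨(hGc w hw).mono_left nhdsWithin_le_nhds, ?_⟩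
      filter_upwards [mem_nhdsWithin_of_mem_nhds (hUo.mem_nhds hw), self_mem_nhdsWithin]
        with y hy hne heq
      exact hne (by rw [mem_singleton_iff, ← hgG y hy, ← hgG w hw]; exact congrArg g heq)
    refine (Complex.analyticAt_of_differentiable_on_punctured_nhds_of_continuousAt ?_
      (hGc w hw)).differentiableAt
    filter_upwards [htend.eventually hev, mem_nhdsWithin_of_mem_nhds (hUo.mem_nhds hw)]
      with y hy hyU using hGreg y hyU hy
  have hfU : ∀ z ∈ D, f z ∈ U := fun z hz => by
    rw [← hf.image_eq]; exact mem_image_of_mem f hz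
  refine ⟨fun z => G (f z), ?_, fun z hz => hGm _ (hfU z hz), ?_, fun z hz => hgG _ (hfU z hz)⟩
  · intro z hz
    exact ((hGd _ (hfU z hz)).comp z
      (hf.differentiableOn.differentiableAt (hDo.mem_nhds hz))).differentiableWithinAt
  · have := hGg 0 h0D
    simpa [hf.map_zero, hg.map_zero] using this

/-- Two univalent maps of the disc onto the same domain that fix the origin differ by a rotation. -/
theorem IsUnivalentOnto.exists_rotation {f g : ℂ → ℂ} {U : Set ℂ}
    (hf : IsUnivalentOnto f U) (hg : IsUnivalentOnto g U) :
    ∃ α : ℝ, ∀ z ∈ ball (0 : ℂ) 1, f z = g (Complex.exp (α * Complex.I) * z) := by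
  obtain ⟨h, hd, hm, h0, hgh⟩ := hf.exists_transition hg
  obtain ⟨k, kd, km, k0, hfk⟩ := hg.exists_transition hf
  have hkh : ∀ z ∈ ball (0 : ℂ) 1, k (h z) = z := fun z hz =>
    hf.injOn (km (hm hz)) hz (by rw [hfk _ (hm hz), hgh z hz])
  have hle : ∀ z ∈ ball (0 : ℂ) 1, ‖h z‖ ≤ ‖z‖ := fun z hz =>
    Complex.norm_le_norm_of_mapsTo_ball hd (fun w hw => ball_subset_closedBall (hm hw)) h0
      (by simpa using hz)
  have hle' : ∀ z ∈ ball (0 : ℂ) 1, ‖k z‖ ≤ ‖z‖ := fun z hz =>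
    Complex.norm_le_norm_of_mapsTo_ball kd (fun w hw => ball_subset_closedBall (km hw)) k0
      (by simpa using hz)
  have hhalf : (1 / 2 : ℂ) ∈ ball (0 : ℂ) 1 := by simp; norm_num
  have hnorm : ‖h (1 / 2)‖ = ‖(1 / 2 : ℂ)‖ :=
    le_antisymm (hle _ hhalf) (by have := hle' _ (hm hhalf); rwa [hkh _ hhalf] at this)
  obtain ⟨C, hC, hCe⟩ := Complex.affine_of_mapsTo_ball_of_exists_norm_dslope_eq_div'
    (R₂ := 1) hd (by rw [h0]; exact fun w hw => ball_subset_closedBall (hm hw))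
    ⟨1 / 2, hhalf, by
      rw [dslope_of_ne _ (by norm_num), slope_def_field, h0, sub_zero, sub_zero, norm_div, hnorm]
      norm_num⟩
  refine ⟨Complex.arg C, fun z hz => ?_⟩
  have hCexp : Complex.exp (Complex.arg C * Complex.I) = C := by
    have := Complex.norm_mul_exp_arg_mul_I C
    rwa [hC, div_one, Complex.ofReal_one, one_mul] at this
  rw [hCexp, ← hgh z hz, hCe hz]
  simp [h0, mul_comm]

theorem lintegral_periodic_shift {F : ℝ → ℝ≥0∞} (hF : Function.Periodic F (2 * Real.pi)) (α : ℝ) :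
    ∫⁻ t in Ioc 0 (2 * Real.pi), F (t + α) = ∫⁻ t in Ioc 0 (2 * Real.pi), F t := by
  have hpre : (fun t : ℝ => t + α) ⁻¹' Ioc α (α + 2 * Real.pi) = Ioc 0 (2 * Real.pi) := by
    ext t
    simp only [mem_preimage, mem_Ioc]
    constructor <;> intro h <;> constructor <;> linarith [h.1, h.2]
  have h1 := (measurePreserving_add_right (volume : Measure ℝ) α).setLIntegral_comp_preimage_emb
    (MeasurableEquiv.addRight α).measurableEmbedding F (Ioc α (α + 2 * Real.pi))
  rw [hpre] at h1
  rw [h1]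
  have : VAddInvariantMeasure (AddSubgroup.zmultiples (2 * Real.pi)) ℝ volume :=
    ⟨fun c s _ => measure_preimage_add _ _ _⟩
  have h2 := IsAddFundamentalDomain.setLIntegral_eq (G := AddSubgroup.zmultiples (2 * Real.pi))
    (isAddFundamentalDomain_Ioc Real.two_pi_pos α) (isAddFundamentalDomain_Ioc Real.two_pi_pos 0)
    F hF.map_vadd_zmultiples
  simpa using h2

theorem circleMap_rotate (r t α : ℝ) :
    Complex.exp (α * Complex.I) * circleMap 0 r t = circleMap 0 r (t + α) := by
  simp only [circleMap, zero_add, Complex.ofReal_add, add_mul, Complex.exp_add]; ring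

theorem circleMap_mem_unitBall {r : ℝ} (h0 : 0 ≤ r) (h1 : r < 1) (t : ℝ) :
    circleMap 0 r t ∈ ball (0 : ℂ) 1 := by
  simp [abs_of_nonneg h0, h1]

theorem mapPerimeter_eq_of_rotation {f g : ℂ → ℂ} {α : ℝ} (hg : DifferentiableOn ℂ g (ball 0 1))
    (h : ∀ z ∈ ball (0 : ℂ) 1, f z = g (Complex.exp (α * Complex.I) * z)) :
    mapPerimeter f = mapPerimeter g := by
  unfold mapPerimeter hardyNorm
  congr 1
  refine iSup_congr fun r => iSup_congr fun hr => ?_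
  congr 2
  have hder : ∀ z ∈ ball (0 : ℂ) 1, ‖deriv f z‖ₑ =
      ‖deriv g (Complex.exp (α * Complex.I) * z)‖ₑ := by
    intro z hz
    have hz' : Complex.exp (α * Complex.I) * z ∈ ball (0 : ℂ) 1 := by
      simpa [Complex.norm_exp_ofReal_mul_I] using hz
    have hgd := (hg.differentiableAt (isOpen_ball.mem_nhds hz')).hasDerivAt
    have h1 : HasDerivAt (fun w => g (Complex.exp (α * Complex.I) * w))
        (deriv g (Complex.exp (α * Complex.I) * z) * (Complex.exp (α * Complex.I) * 1)) z :=
      HasDerivAt.comp z hgd ((hasDerivAt_id z).const_mul _)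
    have h2 : f =ᶠ[𝓝 z] fun w => g (Complex.exp (α * Complex.I) * w) := by
      filter_upwards [isOpen_ball.mem_nhds hz] with w hw using h w hw
    rw [h2.deriv_eq, h1.deriv, mul_one, enorm_mul, ← ofReal_norm (Complex.exp _),
      Complex.norm_exp_ofReal_mul_I]
    simp
  rw [← lintegral_periodic_shift (F := fun θ => ‖deriv g (circleMap 0 r θ)‖ₑ ^ (1 : ℝ)) _ α]
  · refine lintegral_congr fun t => ?_
    rw [hder _ (circleMap_mem_unitBall hr.1 hr.2 t), circleMap_rotate]
  · intro t; simp only [periodic_circleMap 0 r t]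

theorem kineticEnergy_shift_le (u : ℝ → ℝ) (α : ℝ) :
    kineticEnergy (fun t => u (t + α)) ≤ kineticEnergy u := by
  unfold kineticEnergy
  refine le_iInf₂ fun v hv => ?_
  have hshift : ∀ F : ℝ → ℝ, Function.Periodic F (2 * Real.pi) →
      ∫ t in (0 : ℝ)..(2 * Real.pi), F (t + α) = ∫ t in (0 : ℝ)..(2 * Real.pi), F t := by
    intro F hF
    rw [intervalIntegral.integral_comp_add_right]
    have := hF.intervalIntegral_add_eq α 0
    rw [zero_add] at this
    rw [zero_add, add_comm, this]
  have hint : ∀ F : ℝ → ℝ, Function.Periodic F (2 * Real.pi) →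
      IntervalIntegrable F volume 0 (2 * Real.pi) →
      IntervalIntegrable (fun t => F (t + α)) volume 0 (2 * Real.pi) := by
    intro F hF hi
    have := (hF.intervalIntegrable₀ Real.two_pi_pos.ne' hi α (2 * Real.pi + α)).comp_add_right α
    simpa using this
  have hper : ∀ F : ℝ → ℝ, Function.Periodic F (2 * Real.pi) →
      Function.Periodic (fun t => F (t + α)) (2 * Real.pi) := by
    intro F hF t
    have := hF (t + α)
    simpa [add_right_comm] using this
  refine iInf₂_le_of_le (fun t => v (t + α))
    ⟨hper u hv.periodic, hper v hv.periodic_deriv, hint u hv.periodic hv.intervalIntegrable,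
      hint v hv.periodic_deriv hv.intervalIntegrable_deriv, fun φ hφ hφp => ?_⟩ ?_
  · have hψp : Function.Periodic (fun t => φ (t - α)) (2 * Real.pi) := by
      intro t
      have := hφp (t - α)
      simpa [sub_add_eq_add_sub] using this
    have hψd : deriv (fun t => φ (t - α)) = fun t => deriv φ (t - α) := by
      funext t; exact deriv_comp_sub_const ..
    have hdp : Function.Periodic (deriv (fun t => φ (t - α))) (2 * Real.pi) := by
      intro t
      rw [← deriv_comp_add_const]
      congr 1
      funext s
      exact hψp s
    have key := hv.integral_eq (fun t => φ (t - α)) (hφ.comp (contDiff_id.sub contDiff_const)) hψp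
    have e1 := hshift (fun t => u t * deriv (fun t => φ (t - α)) t) (hv.periodic.mul hdp)
    have e2 := hshift (fun t => v t * φ (t - α)) (hv.periodic_deriv.mul hψp)
    rw [← e1, ← e2, hψd] at key
    simpa using key
  · rw [lintegral_periodic_shift (F := fun t => ‖v t‖ₑ ^ 2)
      (fun t => by simp only [hv.periodic_deriv t]) α]

theorem mapEnergy_le_of_rotation {f g : ℂ → ℂ} {α : ℝ}
    (h : ∀ z ∈ ball (0 : ℂ) 1, f z = g (Complex.exp (α * Complex.I) * z)) :
    mapEnergy f ≤ mapEnergy g := by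
  unfold mapEnergy
  refine le_iInf₂ fun u hu => ?_
  have hev : ∀ᶠ r : ℝ in 𝓝[<] 1, ∀ t, f (circleMap 0 r t) = g (circleMap 0 r (t + α)) := by
    filter_upwards [Ioo_mem_nhdsLT (zero_lt_one' ℝ)] with r hr t
    rw [h _ (circleMap_mem_unitBall hr.1.le hr.2 t), circleMap_rotate]
  refine iInf₂_le_of_le (fun t => u (t + α)) ⟨?_, ?_, ?_⟩ (kineticEnergy_shift_le u α)
  · intro t
    have := hu.periodic (t + α)
    simpa [add_right_comm] using this
  · have := (measurePreserving_add_right (volume : Measure ℝ) α).quasiMeasurePreserving.ae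
      hu.radial_limit
    filter_upwards [this] with t ht
    refine ht.congr' ?_
    filter_upwards [hev] with r hr
    rw [hr t]
  · refine hu.tendsto_L1.congr' ?_
    filter_upwards [hev] with r hr
    rw [← lintegral_periodic_shift (F := fun t => ‖(g (circleMap 0 r t)).re - u t‖ₑ) _ α]
    · exact lintegral_congr fun t => by rw [hr t]
    · intro t; simp only [periodic_circleMap 0 r t, hu.periodic t]

theorem domainPerimeter_eq {f : ℂ → ℂ} {U : Set ℂ} (hf : IsUnivalentOnto f U) :
    domainPerimeter U = mapPerimeter f := by
  refine le_antisymm (iInf₂_le f hf) (le_iInf₂ fun g hg => ?_)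
  obtain ⟨α, hα⟩ := hf.exists_rotation hg
  exact (mapPerimeter_eq_of_rotation hg.differentiableOn hα).le

theorem skorokhodEnergy_eq {f : ℂ → ℂ} {U : Set ℂ} (hf : IsUnivalentOnto f U) :
    skorokhodEnergy U = mapEnergy f := by
  refine le_antisymm (iInf₂_le f hf) (le_iInf₂ fun g hg => ?_)
  obtain ⟨α, hα⟩ := hf.exists_rotation hg
  exact mapEnergy_le_of_rotation hα

/-! The area bound is Carleman's argument. Since `f` is injective, `f'` has no zeros on the disc, so
`f' = s²` with `s = Σ bₙ zⁿ` holomorphic. Parseval on circles gives `Σ |bₙ|² ≤ H₁(f')`. The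
coefficients of `f'` are the Cauchy products `cₙ = Σ_{p+q=n} b_p b_q`, and the area is `∫ |f'|² = π
Σ |cₙ|² / (n+1)`. Cauchy–Schwarz over the `n+1` pairs cancels the weight
(`tsum_enorm_sq_antidiagonal_le`), so the area is at most `π H₁(f')² = ℓ² / 4π`
(`IsUnivalentOnto.volume_le_mapPerimeter_sq`).

For the energy bound let `f = Σ aₙ zⁿ`. Convergence in `L¹` makes `aₙ / 2` the `n`th Fourier
coefficient of the boundary function for `n ≥ 1`, and the weak derivative multiplies it by `i n`. As
that derivative is real, the frequencies `±n` contribute equally to Parseval, whence `Σ n² |aₙ|² ≤ 4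
𝔈(u)` (`IsBoundaryRealPart.tsum_enorm_sq_le`). The left side dominates every circular mean of
`|f'|²`, so Cauchy–Schwarz gives `H₁(f')² ≤ 4Λ`, that is `ℓ² / 4π ≤ 4πΛ` (`mapPerimeter_sq_div_le`).

Finite energy also gives `Σ |aₙ| < ∞`, so `f` extends continuously to the closed disc and the
frontier lies on the image of the unit circle. The Hausdorff measure of that curve is at most its
length, which by lower semicontinuity is bounded by the lengths of the images of circles `|z| = r <
1`, each at most `ℓ` (`IsUnivalentOnto.hausdorffMeasure_frontier_le`). -/

/-! ### Fourier coefficients and Parseval for power series on circles -/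

theorem integral_exp_int_mul_I (m : ℤ) :
    ∫ t in (0 : ℝ)..(2 * Real.pi), Complex.exp (m * t * Complex.I) =
      if m = 0 then 2 * (Real.pi : ℂ) else 0 := by
  split_ifs with h
  · simp [h]
  · have hc : (m * Complex.I : ℂ) ≠ 0 := by simp [h]
    have : ∀ t : ℝ, Complex.exp (m * t * Complex.I) = Complex.exp (m * Complex.I * t) := by
      intro t; congr 1; ring
    simp_rw [this]
    rw [integral_exp_mul_complex hc]
    have e : (m * Complex.I * ((2 * Real.pi : ℝ) : ℂ)) = m * (2 * Real.pi * Complex.I) := by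
      push_cast; ring
    rw [e, Complex.exp_int_mul_two_pi_mul_I]
    simp

theorem fourierCoeffOn_two_pi (F : ℝ → ℂ) (n : ℤ) :
    fourierCoeffOn Real.two_pi_pos F n =
      (2 * Real.pi : ℂ)⁻¹ *
        ∫ t in (0 : ℝ)..(2 * Real.pi), Complex.exp (-n * t * Complex.I) * F t := by
  have hpi : (Real.pi : ℂ) ≠ 0 := by exact_mod_cast Real.pi_ne_zero
  rw [fourierCoeffOn_eq_integral]
  simp only [sub_zero, one_div, Complex.real_smul, Complex.ofReal_inv, Complex.ofReal_mul,
    Complex.ofReal_ofNat, smul_eq_mul]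
  congr 1
  refine intervalIntegral.integral_congr fun t _ => ?_
  simp only [fourier_coe_apply]
  congr 2
  push_cast
  field_simp
  ring

theorem tsum_enorm_sq_fourierCoeffOn {F : ℝ → ℂ}
    (hF : MemLp F 2 (volume.restrict (Ioc 0 (2 * Real.pi)))) :
    ∑' n : ℤ, ‖fourierCoeffOn Real.two_pi_pos F n‖ₑ ^ 2 =
      (ENNReal.ofReal (2 * Real.pi))⁻¹ * ∫⁻ t in Ioc 0 (2 * Real.pi), ‖F t‖ₑ ^ 2 := by
  have h := hasSum_sq_fourierCoeffOn Real.two_pi_pos hF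
  have h1 : ∑' n : ℤ, ‖fourierCoeffOn Real.two_pi_pos F n‖ₑ ^ 2 =
      ENNReal.ofReal (∑' n : ℤ, ‖fourierCoeffOn Real.two_pi_pos F n‖ ^ 2) := by
    rw [ENNReal.ofReal_tsum_of_nonneg (fun _ => by positivity) h.summable]
    refine tsum_congr fun n => ?_
    rw [ENNReal.ofReal_pow (norm_nonneg _), ofReal_norm]
  rw [h1, h.tsum_eq, sub_zero, smul_eq_mul, ENNReal.ofReal_mul (by positivity),
    ENNReal.ofReal_inv_of_pos Real.two_pi_pos, intervalIntegral.integral_of_le Real.two_pi_pos.le,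
    ofReal_integral_eq_lintegral_ofReal]
  · congr 1
    refine lintegral_congr fun t => ?_
    rw [ENNReal.ofReal_pow (norm_nonneg _), ofReal_norm]
  · exact hF.integrable_norm_pow (by norm_num)
  · exact Eventually.of_forall fun t => by positivity

theorem continuous_comp_circleMap {F : ℂ → ℂ} (hF : ContinuousOn F (ball 0 1)) {r : ℝ} (h0 : 0 ≤ r)
    (h1 : r < 1) : Continuous fun t => F (circleMap 0 r t) :=
  hF.comp_continuous (continuous_circleMap 0 r) (circleMap_mem_unitBall h0 h1)

theorem summable_norm_mul_pow {F : ℂ → ℂ} {c : ℕ → ℂ} {r : ℝ}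
    (h0 : 0 ≤ r) (h1 : r < 1) (hc : ∀ z ∈ ball (0 : ℂ) 1, HasSum (fun n => c n * z ^ n) (F z)) :
    Summable fun n => ‖c n‖ * r ^ n := by
  have := (hc r (by simpa [abs_of_nonneg h0] using h1)).summable.norm
  simpa [abs_of_nonneg h0] using this

/-- Absolute convergence on `|z| = r < 1` permits termwise integration, and orthogonality of the
exponentials leaves at most the term of degree `m`; negative frequencies match no term. -/
theorem integral_exp_mul_comp_circleMap {F : ℂ → ℂ} {c : ℕ → ℂ} {r : ℝ}
    (h0 : 0 ≤ r) (h1 : r < 1) (hc : ∀ z ∈ ball (0 : ℂ) 1, HasSum (fun n => c n * z ^ n) (F z))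
    (m : ℤ) :
    ∫ t in (0 : ℝ)..(2 * Real.pi), Complex.exp (-m * t * Complex.I) * F (circleMap 0 r t) =
      if 0 ≤ m then 2 * Real.pi * (c m.toNat * r ^ m.toNat) else 0 := by
  have hs := summable_norm_mul_pow h0 h1 hc
  have key := intervalIntegral.hasSum_integral_of_dominated_convergence
    (μ := volume) (a := 0) (b := 2 * Real.pi)
    (F := fun n (t : ℝ) => Complex.exp (-m * t * Complex.I) * (c n * circleMap 0 r t ^ n))
    (f := fun t => Complex.exp (-m * t * Complex.I) * F (circleMap 0 r t))
    (fun n _ => ‖c n‖ * r ^ n)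
    (fun n => Continuous.aestronglyMeasurable (by fun_prop))
    (fun n => Eventually.of_forall fun t _ => by
      have : (-m * t * Complex.I : ℂ) = ((-m * t : ℝ) : ℂ) * Complex.I := by push_cast; ring
      rw [norm_mul, this, Complex.norm_exp_ofReal_mul_I]
      simp [abs_of_nonneg h0])
    (Eventually.of_forall fun t _ => hs) intervalIntegrable_const
    (Eventually.of_forall fun t _ => (hc _ (circleMap_mem_unitBall h0 h1 t)).mul_left _)
  have hterm : ∀ n : ℕ, ∫ t in (0 : ℝ)..(2 * Real.pi),
      Complex.exp (-m * t * Complex.I) * (c n * circleMap 0 r t ^ n) =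
      if (n : ℤ) = m then 2 * Real.pi * (c n * r ^ n) else 0 := by
    intro n
    have : ∀ t : ℝ, Complex.exp (-m * t * Complex.I) * (c n * circleMap 0 r t ^ n) =
        c n * r ^ n * Complex.exp (((n : ℤ) - m : ℤ) * t * Complex.I) := by
      intro t
      have e : (((n : ℤ) - m : ℤ) * t * Complex.I : ℂ) =
          -m * t * Complex.I + n * (t * Complex.I) := by
        push_cast; ring
      rw [e, Complex.exp_add, Complex.exp_nat_mul]
      simp only [circleMap, zero_add, mul_pow]
      ring
    simp_rw [this]
    rw [intervalIntegral.integral_const_mul, integral_exp_int_mul_I]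
    simp only [sub_eq_zero]
    split_ifs <;> ring
  simp_rw [hterm] at key
  rw [← key.tsum_eq]
  split_ifs with hm
  · obtain ⟨k, rfl⟩ := Int.eq_ofNat_of_zero_le hm
    rw [tsum_eq_single k]
    · simp
    · intro n hn
      simp [hn]
  · exact (tsum_congr fun n => if_neg (by omega)).trans tsum_zero

/-- Parseval's identity for a power series on a circle inside the unit disc. -/
theorem circle_mean_sq_eq_tsum {F : ℂ → ℂ} {c : ℕ → ℂ} {r : ℝ} (hF : ContinuousOn F (ball 0 1))
    (h0 : 0 ≤ r) (h1 : r < 1) (hc : ∀ z ∈ ball (0 : ℂ) 1, HasSum (fun n => c n * z ^ n) (F z)) :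
    (ENNReal.ofReal (2 * Real.pi))⁻¹ *
      ∫⁻ t in Ioc 0 (2 * Real.pi), ‖F (circleMap 0 r t)‖ₑ ^ 2 =
      ∑' n, ‖c n‖ₑ ^ 2 * ENNReal.ofReal r ^ (2 * n) := by
  have hcont := continuous_comp_circleMap hF h0 h1
  have hL2 : MemLp (fun t => F (circleMap 0 r t)) 2 (volume.restrict (Ioc 0 (2 * Real.pi))) := by
    obtain ⟨C, hC⟩ := (isCompact_Icc (a := (0 : ℝ)) (b := 2 * Real.pi)).exists_bound_of_continuousOn
      hcont.continuousOn
    exact MemLp.of_bound hcont.aestronglyMeasurable C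
      ((ae_restrict_iff' measurableSet_Ioc).2
        (Eventually.of_forall fun t ht => hC t (Ioc_subset_Icc_self ht)))
  rw [← tsum_enorm_sq_fourierCoeffOn hL2]
  have hpi : (Real.pi : ℂ) ≠ 0 := by exact_mod_cast Real.pi_ne_zero
  simp_rw [fourierCoeffOn_two_pi, integral_exp_mul_comp_circleMap h0 h1 hc]
  have hinj : Function.Injective ((↑) : ℕ → ℤ) := Nat.cast_injective
  rw [← hinj.tsum_eq]
  · refine tsum_congr fun n => ?_
    have : (2 * (Real.pi : ℂ))⁻¹ * (2 * Real.pi * (c n * r ^ n)) = c n * r ^ n := by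
      field_simp
    simp only [Nat.cast_nonneg, if_true, Int.toNat_natCast, this]
    rw [enorm_mul, mul_pow, enorm_pow, ← pow_mul, mul_comm n 2, ← ofReal_norm (r : ℂ),
      Complex.norm_real, Real.norm_of_nonneg h0]
  · intro n hn
    by_contra hcon
    have : ¬ 0 ≤ n := fun h => hcon ⟨n.toNat, by simp [h]⟩
    simp [this] at hn
open Finset.HasAntidiagonal (antidiagonal)

/-! ### Taylor series, nonvanishing derivative and square roots -/

theorem DifferentiableOn.exists_hasSum_pow {F : ℂ → ℂ} (hF : DifferentiableOn ℂ F (ball 0 1)) :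
    ∃ c : ℕ → ℂ, ∀ z ∈ ball (0 : ℂ) 1, HasSum (fun n => c n * z ^ n) (F z) := by
  refine ⟨fun n => (n.factorial : ℂ)⁻¹ * iteratedDeriv n F 0, fun z hz => ?_⟩
  convert! Complex.hasSum_taylorSeries_on_ball hF hz using 2 with n
  simp only [sub_zero, smul_eq_mul]; ring

theorem exists_hasSum_pow_deriv {f : ℂ → ℂ}
    (hf : DifferentiableOn ℂ f (ball 0 1)) :
    ∃ a : ℕ → ℂ, (∀ z ∈ ball (0 : ℂ) 1, HasSum (fun n => a n * z ^ n) (f z)) ∧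
      ∀ z ∈ ball (0 : ℂ) 1,
        HasSum (fun n : ℕ => ((n : ℂ) + 1) * a (n + 1) * z ^ n) (deriv f z) := by
  refine ⟨fun n : ℕ => (n.factorial : ℂ)⁻¹ * iteratedDeriv n f 0, fun z hz => ?_, fun z hz => ?_⟩
  · convert! Complex.hasSum_taylorSeries_on_ball hf hz using 2 with n
    simp only [sub_zero, smul_eq_mul]; ring
  · convert! Complex.hasSum_taylorSeries_on_ball (hf.deriv isOpen_ball) hz using 2 with n
    have : (n.factorial : ℂ) ≠ 0 := by exact_mod_cast n.factorial_ne_zero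
    have : (n : ℂ) + 1 ≠ 0 := by exact_mod_cast n.succ_ne_zero
    simp only [iteratedDeriv_succ', Nat.factorial_succ, sub_zero, smul_eq_mul]
    push_cast; field_simp

/-- The derivative of an injective holomorphic function on an open connected set does not
vanish. -/
theorem Set.InjOn.deriv_ne_zero_of_differentiableOn {f : ℂ → ℂ} {D : Set ℂ} (hinj : InjOn f D)
    (hf : DifferentiableOn ℂ f D) (hDo : IsOpen D) (hDc : IsPreconnected D) {a : ℂ} (ha : a ∈ D) :
    deriv f a ≠ 0 := by
  have hfa : AnalyticOnNhd ℂ f D := hf.analyticOnNhd hDo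
  obtain ⟨b, hb, hab⟩ : ∃ b ∈ D, b ≠ a := by
    have : ∀ᶠ z in 𝓝[≠] a, z ∈ D := mem_nhdsWithin_of_mem_nhds (hDo.mem_nhds ha)
    obtain ⟨b, hb1, hb2⟩ := (this.and self_mem_nhdsWithin).exists
    exact ⟨b, hb1, hb2⟩
  have hnc : ¬ ∃ w, ∀ z ∈ D, f z = w := fun ⟨w, hw⟩ =>
    hab (hinj hb ha (by rw [hw b hb, hw a ha]))
  have hopen := (hfa.is_constant_or_isOpen hDc).resolve_left hnc
  -- The inverse `G` is continuous by the open mapping theorem. Once it is known to be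
  -- differentiable at `f a`, the chain rule for `G ∘ f = id` forces `deriv f a ≠ 0`.
  set G := Function.invFunOn f D with hG
  have hGf : ∀ z ∈ D, G (f z) = z := fun z hz => hinj.leftInvOn_invFunOn hz
  have hfG : ∀ w ∈ f '' D, f (G w) = w := fun w hw => Function.invFunOn_eq hw
  have hGm : ∀ w ∈ f '' D, G w ∈ D := fun w hw => Function.invFunOn_mem hw
  have hUo : IsOpen (f '' D) := hopen D subset_rfl hDo
  have hGc : ∀ w ∈ f '' D, ContinuousAt G w := by
    intro w hw
    rw [ContinuousAt, tendsto_def]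
    intro V hV
    obtain ⟨V', hV'V, hV'o, hV'm⟩ := _root_.mem_nhds_iff.1 hV
    have h1 : IsOpen (f '' (V' ∩ D)) := hopen _ inter_subset_right (hV'o.inter hDo)
    refine mem_of_superset (h1.mem_nhds ⟨G w, ⟨hV'm, hGm w hw⟩, hfG w hw⟩) ?_
    rintro _ ⟨z, ⟨hz1, hz2⟩, rfl⟩
    simpa [hGf z hz2] using hV'V hz1
  have hev : ∀ᶠ z in 𝓝[≠] a, deriv f z ≠ 0 := by
    by_contra hcon
    have hz : EqOn (deriv f) 0 D :=
      hfa.deriv.eqOn_zero_of_preconnected_of_frequently_eq_zero hDc ha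
        (fun hc => hcon (by simpa using hc))
    exact hnc ⟨f a, fun z hz' => hDo.is_const_of_deriv_eq_zero hDc hf hz hz' ha⟩
  have haU : f a ∈ f '' D := mem_image_of_mem f ha
  have htend : Tendsto G (𝓝[≠] (f a)) (𝓝[≠] a) := by
    refine tendsto_nhdsWithin_iff.2 ⟨?_, ?_⟩
    · have := (hGc _ haU).mono_left (nhdsWithin_le_nhds (s := {f a}ᶜ))
      rwa [hGf a ha] at this
    · filter_upwards [mem_nhdsWithin_of_mem_nhds (hUo.mem_nhds haU), self_mem_nhdsWithin]
        with y hy hne heq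
      exact hne (by rw [mem_singleton_iff, ← hfG y hy]; exact congrArg f heq)
  -- Zeros of `deriv f` are isolated, so `G` is differentiable on a punctured neighbourhood of `f
  -- a`; being continuous at `f a`, it has a removable singularity there.
  have hGd : DifferentiableAt ℂ G (f a) := by
    refine (Complex.analyticAt_of_differentiable_on_punctured_nhds_of_continuousAt ?_
      (hGc _ haU)).differentiableAt
    filter_upwards [htend.eventually hev, mem_nhdsWithin_of_mem_nhds (hUo.mem_nhds haU)]
      with y hy hyU
    refine (HasDerivAt.of_local_left_inverse (hGc y hyU)
      (hf.differentiableAt (hDo.mem_nhds (hGm y hyU))).hasDerivAt hy ?_).differentiableAt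
    filter_upwards [hUo.mem_nhds hyU] with x hx using hfG x hx
  have hcomp : HasDerivAt (fun z => G (f z)) (deriv G (f a) * deriv f a) a :=
    hGd.hasDerivAt.comp a (hf.differentiableAt (hDo.mem_nhds ha)).hasDerivAt
  have hid : HasDerivAt (fun z => G (f z)) 1 a :=
    (hasDerivAt_id a).congr_of_eventuallyEq (by
      filter_upwards [hDo.mem_nhds ha] with z hz using hGf z hz)
  intro h
  have := hcomp.unique hid
  simp [h] at this

/-- A nonvanishing holomorphic function on a disc has a holomorphic square root. -/
theorem DifferentiableOn.exists_sq_eq_on_ball {F : ℂ → ℂ} {a : ℂ} {R : ℝ}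
    (hF : DifferentiableOn ℂ F (ball a R)) (h0 : ∀ z ∈ ball a R, F z ≠ 0) :
    ∃ s : ℂ → ℂ, DifferentiableOn ℂ s (ball a R) ∧ ∀ z ∈ ball a R, s z ^ 2 = F z := by
  rcases le_or_gt R 0 with hR | hR
  · rw [ball_eq_empty.2 hR]
    exact ⟨0, by simp, by simp⟩
  have ha : a ∈ ball a R := mem_ball_self hR
  -- `l` is a primitive of `F' / F` with `l a = log (F a)`, a branch of `log F`: `exp (-l) * F` has
  -- zero derivative and equals `1` at `a`. The square root is `exp (l / 2)`.
  obtain ⟨l, hla, hl⟩ := (DifferentiableOn.isExactOn_ball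
    ((hF.deriv isOpen_ball).div hF h0)).with_val_at a (Complex.log (F a))
  have hconst : ∀ z ∈ ball a R, Complex.exp (-l z) * F z = Complex.exp (-l a) * F a := by
    have hd : ∀ z ∈ ball a R, HasDerivAt (fun z => Complex.exp (-l z) * F z) 0 z := by
      intro z hz
      have h1 := (hl z hz).fun_neg.cexp.mul
        (hF.differentiableAt (isOpen_ball.mem_nhds hz)).hasDerivAt
      have hz0 := h0 z hz
      refine h1.congr_deriv (g' := 0) ?_
      simp only [Pi.div_apply]
      field_simp
      ring
    intro z hz
    exact isOpen_ball.is_const_of_deriv_eq_zero (convex_ball a R).isPreconnected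
      (fun w hw => (hd w hw).differentiableAt.differentiableWithinAt)
      (fun w hw => (hd w hw).deriv) hz ha
  refine ⟨fun z => Complex.exp (l z / 2), fun z hz =>
    ((hl z hz).differentiableAt.div_const 2).cexp.differentiableWithinAt, fun z hz => ?_⟩
  have h1 := hconst z hz
  rw [hla, Complex.exp_neg, Complex.exp_neg, Complex.exp_log (h0 a ha),
    inv_mul_cancel₀ (h0 a ha)] at h1
  rw [← Complex.exp_nat_mul]
  have : ((2 : ℕ) : ℂ) * (l z / 2) = l z := by push_cast; ring
  rw [this]
  have := Complex.exp_ne_zero (l z)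
  field_simp at h1
  exact h1.symm

/-! ### Area integrals over the disc -/

/-- Change of variables: multiplication by `w`, as a real-linear map of `ℂ`, has determinant `|w|²`.
-/
theorem volume_image_eq_lintegral_enorm_deriv_sq {f : ℂ → ℂ} {D : Set ℂ}
    (hf : DifferentiableOn ℂ f D) (hDo : IsOpen D) (hinj : InjOn f D) :
    volume (f '' D) = ∫⁻ z in D, ‖deriv f z‖ₑ ^ 2 := by
  rw [← lintegral_abs_det_fderiv_eq_addHaar_image volume hDo.measurableSet
    (fun z hz => ((hf.differentiableAt (hDo.mem_nhds hz)).hasFDerivAt.restrictScalars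
      ℝ).hasFDerivWithinAt) hinj]
  refine lintegral_congr fun z => ?_
  have : (ContinuousLinearMap.restrictScalars ℝ (fderiv ℂ f z)).det = ‖deriv f z‖ ^ 2 := by
    rw [ContinuousLinearMap.det, ContinuousLinearMap.coe_restrictScalars,
      LinearMap.det_restrictScalars, Algebra.norm_complex_apply, Complex.normSq_eq_norm_sq]
    congr 2
    rw [← fderiv_apply_one_eq_deriv, LinearMap.det_ring]
    rfl
  rw [this, abs_of_nonneg (by positivity), ENNReal.ofReal_pow (norm_nonneg _), ofReal_norm]

theorem lintegral_unitBall_eq_polar {φ : ℂ → ℝ≥0∞} (hφ : Measurable φ) :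
    ∫⁻ z in ball (0 : ℂ) 1, φ z =
      ∫⁻ r in Ioo (0 : ℝ) 1,
        ENNReal.ofReal r * ∫⁻ t in Ioc 0 (2 * Real.pi), φ (circleMap 0 r t) := by
  rw [← lintegral_indicator measurableSet_ball, ← Complex.lintegral_comp_polarCoord_symm]
  have hsymm : ∀ p : ℝ × ℝ, Complex.polarCoord.symm p = circleMap 0 p.1 p.2 := by
    intro p
    rw [Complex.polarCoord_symm_apply, circleMap, zero_add, Complex.exp_mul_I]
    push_cast
    ring
  have hind : ∀ p ∈ polarCoord.target, ENNReal.ofReal p.1 •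
      (ball (0 : ℂ) 1).indicator φ (Complex.polarCoord.symm p) =
      (Iio (1 : ℝ) ×ˢ univ).indicator
        (fun p : ℝ × ℝ => ENNReal.ofReal p.1 * φ (circleMap 0 p.1 p.2)) p := by
    rintro ⟨r, t⟩ hp
    have hr : 0 < r := by simpa [polarCoord_target] using hp.1
    rw [hsymm]
    simp [indicator, abs_of_pos hr, smul_eq_mul]
  have hcm : Measurable fun p : ℝ × ℝ => circleMap 0 p.1 p.2 := by
    unfold circleMap; fun_prop
  rw [setLIntegral_congr_fun (by rw [polarCoord_target]; measurability) hind,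
    setLIntegral_indicator (by measurability), polarCoord_target, prod_inter_prod, univ_inter,
    inter_comm, Ioi_inter_Iio, Measure.volume_eq_prod, setLIntegral_prod]
  · refine setLIntegral_congr_fun measurableSet_Ioo fun r hr => ?_
    simp only
    rw [lintegral_const_mul _ (by fun_prop), restrict_Ioo_eq_restrict_Ioc]
    congr 1
    -- Polar coordinates use angles in `(-π, π)`; periodicity moves them to `(0, 2π]`.
    have : VAddInvariantMeasure (AddSubgroup.zmultiples (2 * Real.pi)) ℝ volume :=
      ⟨fun c s _ => measure_preimage_add _ _ _⟩
    have h := IsAddFundamentalDomain.setLIntegral_eq (G := AddSubgroup.zmultiples (2 * Real.pi))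
      (isAddFundamentalDomain_Ioc Real.two_pi_pos (-Real.pi))
      (isAddFundamentalDomain_Ioc Real.two_pi_pos 0) (fun t => φ (circleMap 0 r t))
      ((periodic_circleMap 0 r).comp φ).map_vadd_zmultiples
    have e : -Real.pi + 2 * Real.pi = Real.pi := by ring
    rwa [e, zero_add] at h
  · fun_prop

theorem lintegral_Ioo_pow (n : ℕ) :
    ∫⁻ r in Ioo (0 : ℝ) 1, ENNReal.ofReal r ^ n = ((n : ℝ≥0∞) + 1)⁻¹ := by
  have : ∫⁻ r in Ioo (0 : ℝ) 1, ENNReal.ofReal r ^ n =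
      ∫⁻ r in Ioo (0 : ℝ) 1, ENNReal.ofReal (r ^ n) :=
    setLIntegral_congr_fun measurableSet_Ioo fun r hr => by
      rw [ENNReal.ofReal_pow hr.1.le]
  rw [this, ← ofReal_integral_eq_lintegral_ofReal, ← integral_Ioc_eq_integral_Ioo,
    ← intervalIntegral.integral_of_le zero_le_one, integral_pow]
  · rw [one_pow, zero_pow n.succ_ne_zero, sub_zero, one_div,
      ENNReal.ofReal_inv_of_pos (by positivity)]
    congr 1
    rw [ENNReal.ofReal_add (by positivity) zero_le_one]
    simp
  · exact ((continuous_pow n).integrableOn_Icc).mono_set Ioo_subset_Icc_self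
  · filter_upwards [ae_restrict_mem measurableSet_Ioo] with r hr
    exact pow_nonneg hr.1.le n

/-- The area integral of a power series over the unit disc. -/
theorem lintegral_unitBall_enorm_sq_eq_tsum {F : ℂ → ℂ} {c : ℕ → ℂ} (hF : ContinuousOn F (ball 0 1))
    (hc : ∀ z ∈ ball (0 : ℂ) 1, HasSum (fun n => c n * z ^ n) (F z)) :
    ∫⁻ z in ball (0 : ℂ) 1, ‖F z‖ₑ ^ 2 =
      ENNReal.ofReal Real.pi * ∑' n : ℕ, ‖c n‖ₑ ^ 2 * ((n : ℝ≥0∞) + 1)⁻¹ := by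
  have hpi : ENNReal.ofReal (2 * Real.pi) ≠ 0 := by simp [Real.pi_pos]
  -- Nothing is known of `F` outside the disc, so the globally measurable integrand needed for polar
  -- coordinates is the extension by zero.
  have hmeas : Measurable ((ball (0 : ℂ) 1).indicator fun z => ‖F z‖ₑ ^ 2) := by
    classical
    rw [← piecewise_eq_indicator]
    exact (((ENNReal.continuous_pow 2).comp continuous_enorm).comp_continuousOn hF
      ).measurable_piecewise continuousOn_const measurableSet_ball
  have h1 : ∫⁻ z in ball (0 : ℂ) 1, ‖F z‖ₑ ^ 2 =
      ∫⁻ z in ball (0 : ℂ) 1, (ball (0 : ℂ) 1).indicator (fun z => ‖F z‖ₑ ^ 2) z :=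
    setLIntegral_congr_fun measurableSet_ball fun z hz => by
      simp only [indicator_of_mem hz]
  have h2 : ∀ r ∈ Ioo (0 : ℝ) 1, ENNReal.ofReal r * ∫⁻ t in Ioc 0 (2 * Real.pi),
      (ball (0 : ℂ) 1).indicator (fun z => ‖F z‖ₑ ^ 2) (circleMap 0 r t) =
      ∑' n : ℕ, ENNReal.ofReal (2 * Real.pi) * ‖c n‖ₑ ^ 2 * ENNReal.ofReal r ^ (2 * n + 1) := by
    intro r hr
    have h := circle_mean_sq_eq_tsum hF hr.1.le hr.2 hc
    rw [← ENNReal.div_eq_inv_mul, eq_comm, ENNReal.eq_div_iff hpi ENNReal.ofReal_ne_top] at h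
    simp_rw [indicator_of_mem (circleMap_mem_unitBall hr.1.le hr.2 _)]
    rw [← h, ← ENNReal.tsum_mul_left, ← ENNReal.tsum_mul_left]
    refine tsum_congr fun n => ?_
    rw [pow_succ]
    ring
  rw [h1, lintegral_unitBall_eq_polar hmeas, setLIntegral_congr_fun measurableSet_Ioo h2,
    lintegral_tsum fun n => by fun_prop, ← ENNReal.tsum_mul_left]
  refine tsum_congr fun n => ?_
  rw [lintegral_const_mul _ (by fun_prop), lintegral_Ioo_pow, mul_comm 2 Real.pi,
    ENNReal.ofReal_mul Real.pi_pos.le, ENNReal.ofReal_ofNat]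
  -- The exponent `2n + 1` includes the polar factor `r`; the radial integral is `1 / (2n + 2)`, and
  -- its `2` cancels that of `2π`.
  have h3 : (((2 * n + 1 : ℕ) : ℝ≥0∞) + 1) = 2 * ((n : ℝ≥0∞) + 1) := by
    push_cast; ring
  rw [h3, ENNReal.mul_inv (by simp) (by simp)]
  calc _ = ENNReal.ofReal Real.pi * (‖c n‖ₑ ^ 2 * ((n : ℝ≥0∞) + 1)⁻¹) * (2 * 2⁻¹) := by ring
    _ = _ := by rw [ENNReal.mul_inv_cancel (by simp) (by simp), mul_one]

/-! ### Carleman's inequality and the isoperimetric inequality -/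

theorem ENNReal.tsum_sum_antidiagonal (x y : ℕ → ℝ≥0∞) :
    ∑' n, ∑ p ∈ antidiagonal n, x p.1 * y p.2 = (∑' n, x n) * ∑' n, y n := by
  have h : ∑' p : ℕ × ℕ, x p.1 * y p.2 = (∑' n, x n) * ∑' n, y n := by
    rw [ENNReal.tsum_prod']
    simp_rw [ENNReal.tsum_mul_left, ENNReal.tsum_mul_right]
  rw [← h, ← Finset.HasAntidiagonal.sigmaAntidiagonalEquivProd.tsum_eq, ENNReal.tsum_sigma']
  refine tsum_congr fun n => ?_
  rw [tsum_fintype, ← Finset.sum_coe_sort]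
  rfl

theorem enorm_sum_sq_le_card_mul {ι : Type*} (s : Finset ι) (x : ι → ℂ) :
    ‖∑ i ∈ s, x i‖ₑ ^ 2 ≤ s.card * ∑ i ∈ s, ‖x i‖ₑ ^ 2 := by
  have h : ‖∑ i ∈ s, x i‖ ^ 2 ≤ s.card * ∑ i ∈ s, ‖x i‖ ^ 2 :=
    (pow_le_pow_left₀ (norm_nonneg _) (norm_sum_le _ _) 2).trans sq_sum_le_card_mul_sum_sq
  have := ENNReal.ofReal_le_ofReal h
  rw [ENNReal.ofReal_mul (by positivity), ENNReal.ofReal_natCast,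
    ENNReal.ofReal_sum_of_nonneg (fun _ _ => by positivity)] at this
  simpa only [ENNReal.ofReal_pow (norm_nonneg _), ofReal_norm] using this

/-- The coefficient inequality behind Carleman's proof of the isoperimetric inequality. -/
theorem tsum_enorm_sq_antidiagonal_le (b : ℕ → ℂ) :
    ∑' n : ℕ, ‖∑ p ∈ antidiagonal n, b p.1 * b p.2‖ₑ ^ 2 * ((n : ℝ≥0∞) + 1)⁻¹ ≤
      (∑' n, ‖b n‖ₑ ^ 2) ^ 2 := by
  rw [sq, ← ENNReal.tsum_sum_antidiagonal]
  refine ENNReal.tsum_le_tsum fun n => ?_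
  rw [← div_eq_mul_inv]
  refine ENNReal.div_le_of_le_mul' ?_
  -- The antidiagonal of `n` has `n + 1` elements, exactly the weight being divided out.
  have := enorm_sum_sq_le_card_mul (antidiagonal n) fun p => b p.1 * b p.2
  simpa only [Finset.Nat.card_antidiagonal, Nat.cast_add, Nat.cast_one, enorm_mul, mul_pow]
    using this

/-- Each finite partial sum is continuous in `r`, so the bound survives `r → 1`; the full sum is the
supremum of these. -/
theorem tsum_le_of_tsum_mul_pow_le {x : ℕ → ℝ≥0∞} {C : ℝ≥0∞} {e : ℕ → ℕ}
    (h : ∀ r ∈ Ico (0 : ℝ) 1, ∑' n, x n * ENNReal.ofReal r ^ e n ≤ C) : ∑' n, x n ≤ C := by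
  rw [ENNReal.tsum_eq_iSup_sum]
  refine iSup_le fun s => ?_
  have ht : Tendsto (fun r : ℝ => ∑ n ∈ s, x n * ENNReal.ofReal r ^ e n) (𝓝[<] 1)
      (𝓝 (∑ n ∈ s, x n)) := by
    refine tendsto_finsetSum _ fun n _ => ?_
    have h1 : Tendsto (fun r : ℝ => ENNReal.ofReal r ^ e n) (𝓝[<] 1) (𝓝 1) := by
      have := ((ENNReal.continuous_pow (e n)).comp ENNReal.continuous_ofReal).tendsto (1 : ℝ)
      simp only [Function.comp, ENNReal.ofReal_one, one_pow] at this
      exact this.mono_left nhdsWithin_le_nhds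
    simpa using ENNReal.Tendsto.const_mul (a := x n) h1 (Or.inl one_ne_zero)
  refine le_of_tendsto ht ?_
  filter_upwards [Ioo_mem_nhdsLT (zero_lt_one' ℝ)] with r hr
  exact (ENNReal.sum_le_tsum s).trans (h r ⟨hr.1.le, hr.2⟩)

/-- The isoperimetric inequality for the image of the disc under a univalent map. -/
theorem IsUnivalentOnto.volume_le_mapPerimeter_sq {f : ℂ → ℂ} {U : Set ℂ}
    (hf : IsUnivalentOnto f U) :
    volume U ≤ mapPerimeter f ^ 2 / ENNReal.ofReal (4 * Real.pi) := by
  have hd := hf.differentiableOn.deriv isOpen_ball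
  obtain ⟨s, hs, hsq⟩ := hd.exists_sq_eq_on_ball fun z hz =>
    hf.injOn.deriv_ne_zero_of_differentiableOn hf.differentiableOn isOpen_ball
      (convex_ball _ _).isPreconnected hz
  obtain ⟨b, hb⟩ := hs.exists_hasSum_pow
  have hc : ∀ z ∈ ball (0 : ℂ) 1,
      HasSum (fun n => (∑ p ∈ antidiagonal n, b p.1 * b p.2) * z ^ n) (deriv f z) := by
    intro z hz
    have h1 := (hb z hz).summable.norm
    have h2 := tsum_mul_tsum_eq_tsum_sum_antidiagonal_of_summable_norm h1 h1
    have h3 := (summable_norm_sum_mul_antidiagonal_of_summable_norm h1 h1).of_norm.hasSum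
    rw [← h2, (hb z hz).tsum_eq, ← sq, hsq z hz] at h3
    convert! h3 using 2 with n
    simp only [Finset.sum_mul]
    refine Finset.sum_congr rfl fun p hp => ?_
    rw [← Finset.HasAntidiagonal.mem_antidiagonal.1 hp, pow_add]
    ring
  -- On each circle the mean of `|s|²` is the mean of `|f'|`.
  have hsum : ∑' n, ‖b n‖ₑ ^ 2 ≤ hardyNorm 1 (deriv f) := by
    refine tsum_le_of_tsum_mul_pow_le (e := fun n => 2 * n) fun r hr => ?_
    rw [← circle_mean_sq_eq_tsum hs.continuousOn hr.1 hr.2 hb]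
    refine le_trans (le_of_eq ?_) (le_iSup₂ (f := fun (r : ℝ) (_ : r ∈ Ico (0 : ℝ) 1) =>
      ((ENNReal.ofReal (2 * Real.pi))⁻¹ *
        ∫⁻ θ in Ioc 0 (2 * Real.pi), ‖deriv f (circleMap 0 r θ)‖ₑ ^ (1 : ℝ)) ^ (1 / (1 : ℝ))) r hr)
    simp only [ENNReal.rpow_one, div_one]
    congr 1
    refine lintegral_congr fun t => ?_
    rw [← hsq _ (circleMap_mem_unitBall hr.1 hr.2 t), enorm_pow]
  rw [← hf.image_eq, volume_image_eq_lintegral_enorm_deriv_sq hf.differentiableOn isOpen_ball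
    hf.injOn, lintegral_unitBall_enorm_sq_eq_tsum hd.continuousOn hc]
  calc _ ≤ ENNReal.ofReal Real.pi * hardyNorm 1 (deriv f) ^ 2 := by
        gcongr
        exact (tsum_enorm_sq_antidiagonal_le b).trans (by gcongr)
    _ = _ := by
        rw [mapPerimeter, mul_pow, ENNReal.mul_div_right_comm, ← ENNReal.ofReal_pow (by positivity),
          ← ENNReal.ofReal_div_of_pos (by positivity)]
        congr 2
        field_simp
        ring

/-! ### Fourier coefficients of the boundary function and its weak derivative -/

theorem exp_neg_mul_I_eq (n t : ℝ) :
    Complex.exp (-n * t * Complex.I) =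
      (Real.cos (n * t) : ℂ) - (Real.sin (n * t) : ℂ) * Complex.I := by
  have : (-n * t * Complex.I : ℂ) = (-(n * t : ℝ) : ℂ) * Complex.I := by push_cast; ring
  rw [this, Complex.exp_mul_I, Complex.cos_neg, Complex.sin_neg]
  push_cast; ring

theorem IntervalIntegrable.complex_ofReal {w : ℝ → ℝ} {a b : ℝ}
    (hw : IntervalIntegrable w volume a b) :
    IntervalIntegrable (fun t => (w t : ℂ)) volume a b :=
  ⟨Integrable.ofReal hw.1, Integrable.ofReal hw.2⟩

theorem IntervalIntegrable.integral_exp_mul_ofReal {w : ℝ → ℝ} {a b : ℝ}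
    (hw : IntervalIntegrable w volume a b) (n : ℝ) :
    ∫ t in a..b, Complex.exp (-n * t * Complex.I) * (w t : ℂ) =
      ((∫ t in a..b, w t * Real.cos (n * t) : ℝ) : ℂ) -
        ((∫ t in a..b, w t * Real.sin (n * t) : ℝ) : ℂ) * Complex.I := by
  have h1 : IntervalIntegrable (fun t => w t * Real.cos (n * t)) volume a b :=
    hw.mul_continuousOn (by fun_prop)
  have h2 : IntervalIntegrable (fun t => w t * Real.sin (n * t)) volume a b :=
    hw.mul_continuousOn (by fun_prop)
  rw [← intervalIntegral.integral_ofReal, ← intervalIntegral.integral_ofReal,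
    ← intervalIntegral.integral_mul_const, ← intervalIntegral.integral_sub]
  · refine intervalIntegral.integral_congr fun t _ => ?_
    simp only [exp_neg_mul_I_eq]
    push_cast; ring
  · exact h1.complex_ofReal
  · exact h2.complex_ofReal.mul_const _

/-- Integration by parts against an exponential. The admissible test functions are real, so cosine
and sine are tested separately and recombined. -/
theorem IsPeriodicWeakDeriv.integral_exp_mul {u v : ℝ → ℝ} (h : IsPeriodicWeakDeriv u v) (n : ℕ) :
    ∫ t in (0 : ℝ)..(2 * Real.pi), Complex.exp (-(n : ℝ) * t * Complex.I) * (v t : ℂ) =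
      n * Complex.I *
        ∫ t in (0 : ℝ)..(2 * Real.pi), Complex.exp (-(n : ℝ) * t * Complex.I) * (u t : ℂ) := by
  have hper : ∀ x : ℝ, (n : ℝ) * (x + 2 * Real.pi) = n * x + n * (2 * Real.pi) := fun x => by ring
  have hc := h.integral_eq (fun t => Real.cos (n * t)) (by fun_prop) fun x => by
    simp only [hper, Real.cos_add_nat_mul_two_pi]
  have hs := h.integral_eq (fun t => Real.sin (n * t)) (by fun_prop) fun x => by
    simp only [hper, Real.sin_add_nat_mul_two_pi]
  have dc : deriv (fun t : ℝ => Real.cos (n * t)) = fun t => -n * Real.sin (n * t) := by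
    funext t
    have := ((hasDerivAt_id t).const_mul (n : ℝ)).cos
    simp only [id, mul_one] at this
    rw [this.deriv]; ring
  have ds : deriv (fun t : ℝ => Real.sin (n * t)) = fun t => n * Real.cos (n * t) := by
    funext t
    have := ((hasDerivAt_id t).const_mul (n : ℝ)).sin
    simp only [id, mul_one] at this
    rw [this.deriv]; ring
  simp only [dc, ds, mul_left_comm (u _), intervalIntegral.integral_const_mul] at hc hs
  rw [h.intervalIntegrable.integral_exp_mul_ofReal,
    h.intervalIntegrable_deriv.integral_exp_mul_ofReal,
    ← neg_eq_iff_eq_neg.2 hc, ← neg_eq_iff_eq_neg.2 hs]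
  push_cast
  linear_combination (n : ℂ) * ((∫ t in (0 : ℝ)..(2 * Real.pi), u t * Real.sin (n * t) : ℝ) : ℂ) *
    Complex.I_sq

/-- In `Re F = (F + conj F) / 2` the conjugate has only nonpositive frequencies, so for `m ≥ 1` half
of the coefficient of `F` remains: `π` in place of `2π`. At `m = 0` both halves would contribute. -/
theorem integral_exp_mul_re_comp_circleMap {F : ℂ → ℂ} {c : ℕ → ℂ} {r : ℝ}
    (hF : ContinuousOn F (ball 0 1)) (h0 : 0 ≤ r) (h1 : r < 1)
    (hc : ∀ z ∈ ball (0 : ℂ) 1, HasSum (fun n => c n * z ^ n) (F z)) {m : ℕ} (hm : m ≠ 0) :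
    ∫ t in (0 : ℝ)..(2 * Real.pi), Complex.exp (-(m : ℝ) * t * Complex.I) *
      ((F (circleMap 0 r t)).re : ℂ) = Real.pi * (c m * r ^ m) := by
  have hcont := continuous_comp_circleMap hF h0 h1
  have e1 := integral_exp_mul_comp_circleMap h0 h1 hc (m : ℤ)
  have e2 := integral_exp_mul_comp_circleMap h0 h1 hc (-m : ℤ)
  rw [if_neg (by omega)] at e2
  rw [if_pos (by omega), Int.toNat_natCast] at e1
  have e3 : ∫ t in (0 : ℝ)..(2 * Real.pi), Complex.exp (-(m : ℝ) * t * Complex.I) *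
      (starRingEnd ℂ) (F (circleMap 0 r t)) = 0 := by
    rw [intervalIntegral.integral_of_le Real.two_pi_pos.le] at e2 ⊢
    have e := congrArg (starRingEnd ℂ) e2
    rw [map_zero, ← integral_conj] at e
    refine Eq.trans ?_ e
    refine integral_congr_ae (Eventually.of_forall fun t => ?_)
    simp only [map_mul, ← Complex.exp_conj]
    congr 2
    simp
  have e4 : ∀ t : ℝ, Complex.exp (-(m : ℝ) * t * Complex.I) * ((F (circleMap 0 r t)).re : ℂ) =
      2⁻¹ * (Complex.exp (-(m : ℤ) * t * Complex.I) * F (circleMap 0 r t)) +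
      2⁻¹ * (Complex.exp (-(m : ℝ) * t * Complex.I) *
        (starRingEnd ℂ) (F (circleMap 0 r t))) := by
    intro t
    rw [Complex.re_eq_add_conj]
    push_cast; ring
  have hcc := Complex.continuous_conj.comp hcont
  simp_rw [e4]
  rw [intervalIntegral.integral_add, intervalIntegral.integral_const_mul,
    intervalIntegral.integral_const_mul, e1, e3]
  · ring
  · exact (continuous_const.mul (Continuous.mul (by fun_prop) hcont)).intervalIntegrable _ _
  · exact (continuous_const.mul (Continuous.mul (by fun_prop) hcc)).intervalIntegrable _ _

/-- The `L¹` distance bounds the difference of Fourier integrals, since the exponential has modulus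
one; so the formula on `|z| = r` passes to the limit `r → 1`. Radial limits alone would not suffice.
-/
theorem IsBoundaryRealPart.integral_exp_mul {f : ℂ → ℂ} {u : ℝ → ℝ} {c : ℕ → ℂ}
    (h : IsBoundaryRealPart f u) (hf : ContinuousOn f (ball 0 1))
    (hu : IntervalIntegrable u volume 0 (2 * Real.pi))
    (hc : ∀ z ∈ ball (0 : ℂ) 1, HasSum (fun n => c n * z ^ n) (f z)) {m : ℕ} (hm : m ≠ 0) :
    ∫ t in (0 : ℝ)..(2 * Real.pi), Complex.exp (-(m : ℝ) * t * Complex.I) * (u t : ℂ) =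
      Real.pi * c m := by
  have hexp : ∀ t : ℝ, ‖Complex.exp (-(m : ℝ) * t * Complex.I)‖ = 1 := fun t => by
    have : (-(m : ℝ) * t * Complex.I : ℂ) = ((-m * t : ℝ) : ℂ) * Complex.I := by push_cast; ring
    rw [this, Complex.norm_exp_ofReal_mul_I]
  have hev : ∀ᶠ r : ℝ in 𝓝[<] 1, r ∈ Ioo (0 : ℝ) 1 := Ioo_mem_nhdsLT zero_lt_one
  have hlim : Tendsto (fun r : ℝ => (Real.pi : ℂ) * (c m * r ^ m)) (𝓝[<] 1)
      (𝓝 (Real.pi * (c m * ((1 : ℝ) : ℂ) ^ m))) := by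
    refine Tendsto.mono_left (Continuous.tendsto ?_ (1 : ℝ)) nhdsWithin_le_nhds
    fun_prop
  simp only [Complex.ofReal_one, one_pow, mul_one] at hlim
  refine (tendsto_nhds_unique ?_ hlim)
  rw [tendsto_iff_edist_tendsto_0]
  refine tendsto_of_tendsto_of_tendsto_of_le_of_le' tendsto_const_nhds h.tendsto_L1
    (Eventually.of_forall fun _ => zero_le) ?_
  filter_upwards [hev] with r hr
  have hcont := continuous_comp_circleMap hf hr.1.le hr.2
  rw [← integral_exp_mul_re_comp_circleMap hf hr.1.le hr.2 hc hm, edist_eq_enorm_sub,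
    ← intervalIntegral.integral_sub, intervalIntegral.integral_of_le Real.two_pi_pos.le]
  · refine (enorm_integral_le_lintegral_enorm _).trans (lintegral_mono fun t => ?_)
    rw [← mul_sub, enorm_mul, ← ofReal_norm, hexp, ENNReal.ofReal_one, one_mul,
      ← Complex.ofReal_sub, ← ofReal_norm, Complex.norm_real, ofReal_norm]
  · have hre := Complex.continuous_ofReal.comp (Complex.continuous_re.comp hcont)
    exact (Continuous.mul (by fun_prop) hre).intervalIntegrable _ _
  · exact hu.complex_ofReal.continuousOn_mul (by fun_prop)

/-- The Taylor coefficients of a map with a boundary function of finite energy. -/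
theorem IsBoundaryRealPart.tsum_enorm_sq_le {f : ℂ → ℂ} {u v : ℝ → ℝ} {c : ℕ → ℂ}
    (h : IsBoundaryRealPart f u) (hf : ContinuousOn f (ball 0 1)) (huv : IsPeriodicWeakDeriv u v)
    (hc : ∀ z ∈ ball (0 : ℂ) 1, HasSum (fun n => c n * z ^ n) (f z)) :
    ∑' n : ℕ, ‖((n : ℂ) + 1) * c (n + 1)‖ₑ ^ 2 ≤
      4 * ((1 / 2) * ((ENNReal.ofReal (2 * Real.pi))⁻¹ *
        ∫⁻ t in Ioc 0 (2 * Real.pi), ‖v t‖ₑ ^ 2)) := by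
  have hpi : (Real.pi : ℂ) ≠ 0 := by exact_mod_cast Real.pi_ne_zero
  by_cases htop : ∫⁻ t in Ioc 0 (2 * Real.pi), ‖v t‖ₑ ^ 2 = ⊤
  · rw [htop, ENNReal.mul_top (ENNReal.inv_ne_zero.2 ENNReal.ofReal_ne_top),
      ENNReal.mul_top (by simp), ENNReal.mul_top (by simp)]
    exact le_top
  have hvi := (intervalIntegrable_iff_integrableOn_Ioc_of_le Real.two_pi_pos.le).1
    huv.intervalIntegrable_deriv
  have hv : MemLp (fun t => (v t : ℂ)) 2 (volume.restrict (Ioc 0 (2 * Real.pi))) := by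
    refine MemLp.ofReal ⟨hvi.aestronglyMeasurable, ?_⟩
    rw [eLpNorm_lt_top_iff_lintegral_rpow_enorm_lt_top (by norm_num) (by norm_num)]
    simpa using lt_top_iff_ne_top.2 htop
  -- The factor is `i π / 2π = i / 2`; its squared modulus `1/4` accounts for the `4` in the bound.
  have hcoef : ∀ n : ℕ, fourierCoeffOn Real.two_pi_pos (fun t => (v t : ℂ)) ((n + 1 : ℕ) : ℤ) =
      2⁻¹ * Complex.I * (((n : ℂ) + 1) * c (n + 1)) := by
    intro n
    rw [fourierCoeffOn_two_pi]
    have := huv.integral_exp_mul (n + 1)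
    rw [h.integral_exp_mul hf huv.intervalIntegrable hc n.succ_ne_zero] at this
    push_cast at this ⊢
    rw [this]
    field_simp
  -- `v` is real, so opposite frequencies have conjugate coefficients. Hence Parseval counts the
  -- positive frequencies twice, which absorbs the `1 / 2` of the energy.
  have hconj : ∀ n : ℤ, ‖fourierCoeffOn Real.two_pi_pos (fun t => (v t : ℂ)) (-n)‖ₑ =
      ‖fourierCoeffOn Real.two_pi_pos (fun t => (v t : ℂ)) n‖ₑ := by
    intro n
    rw [← ofReal_norm, ← ofReal_norm, ← RCLike.norm_conj (fourierCoeffOn _ _ n)]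
    congr 2
    simp only [fourierCoeffOn_two_pi, intervalIntegral.integral_of_le Real.two_pi_pos.le, map_mul,
      ← integral_conj, ← Complex.exp_conj]
    simp [map_ofNat (starRingEnd ℂ) 2]
  have hsum := (HasSum.of_nat_of_neg_add_one
    (f := fun n : ℤ => ‖fourierCoeffOn Real.two_pi_pos (fun t => (v t : ℂ)) n‖ₑ ^ 2)
    ENNReal.summable.hasSum ENNReal.summable.hasSum).tsum_eq
  rw [tsum_enorm_sq_fourierCoeffOn hv] at hsum
  have henorm : ∀ t : ℝ, ‖(v t : ℂ)‖ₑ = ‖v t‖ₑ := fun t => by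
    rw [← ofReal_norm, Complex.norm_real, ofReal_norm]
  have hterm : ∀ n : ℕ, ‖((n : ℂ) + 1) * c (n + 1)‖ₑ ^ 2 =
      4 * ‖fourierCoeffOn Real.two_pi_pos (fun t => (v t : ℂ)) ((n + 1 : ℕ) : ℤ)‖ₑ ^ 2 := by
    intro n
    have : ‖(2⁻¹ * Complex.I : ℂ)‖ₑ ^ 2 = 4⁻¹ := by
      rw [← ofReal_norm, ← ENNReal.ofReal_pow (norm_nonneg _)]
      norm_num
      rw [ENNReal.ofReal_div_of_pos (by norm_num)]
      simp
    rw [hcoef, enorm_mul (2⁻¹ * Complex.I), mul_pow, this, ← mul_assoc,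
      ENNReal.mul_inv_cancel (by simp) (by simp), one_mul]
  -- Only the zero frequency is discarded here.
  have hpos : ∑' n : ℕ, ‖fourierCoeffOn Real.two_pi_pos (fun t => (v t : ℂ))
      ((n + 1 : ℕ) : ℤ)‖ₑ ^ 2 ≤
      ∑' n : ℕ, ‖fourierCoeffOn Real.two_pi_pos (fun t => (v t : ℂ)) (n : ℤ)‖ₑ ^ 2 :=
    ENNReal.tsum_comp_le_tsum_of_injective (add_left_injective 1)
      fun n : ℕ => ‖fourierCoeffOn Real.two_pi_pos (fun t => (v t : ℂ)) (n : ℤ)‖ₑ ^ 2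
  simp_rw [henorm] at hsum
  simp_rw [hterm]
  rw [ENNReal.tsum_mul_left, hsum]
  gcongr
  simp only [hconj]
  set S := ∑' n : ℕ, ‖fourierCoeffOn Real.two_pi_pos (fun t => (v t : ℂ)) ((n + 1 : ℕ) : ℤ)‖ₑ ^ 2
  calc S = 1 / 2 * (S + S) := by
        rw [← two_mul, ← mul_assoc, one_div, ENNReal.inv_mul_cancel (by simp) (by simp), one_mul]
    _ ≤ _ := by gcongr; exact_mod_cast le_rfl

/-! ### Perimeter against energy -/

/-- Cauchy–Schwarz against the constant `1` for the normalised measure, which has total mass one. -/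
theorem circle_mean_le_sqrt {g : ℝ → ℝ≥0∞} (hg : Measurable g) :
    (ENNReal.ofReal (2 * Real.pi))⁻¹ * ∫⁻ t in Ioc 0 (2 * Real.pi), g t ≤
      ((ENNReal.ofReal (2 * Real.pi))⁻¹ * ∫⁻ t in Ioc 0 (2 * Real.pi), g t ^ 2) ^ (1 / 2 : ℝ) := by
  have hpi : ENNReal.ofReal (2 * Real.pi) ≠ 0 := by simp [Real.pi_pos]
  have huniv : ((ENNReal.ofReal (2 * Real.pi))⁻¹ • (volume.restrict (Ioc 0 (2 * Real.pi)))) univ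
      = 1 := by
    simp only [Measure.smul_apply, Measure.restrict_apply_univ, Real.volume_Ioc, sub_zero,
      smul_eq_mul, ENNReal.inv_mul_cancel hpi ENNReal.ofReal_ne_top]
  have h := ENNReal.lintegral_mul_le_Lp_mul_Lq
    ((ENNReal.ofReal (2 * Real.pi))⁻¹ • (volume.restrict (Ioc 0 (2 * Real.pi))))
    Real.HolderConjugate.two_two hg.aemeasurable (g := 1) aemeasurable_const
  simpa only [lintegral_const, huniv, lintegral_smul_measure, mul_one, Pi.one_apply, Pi.mul_apply,
    ENNReal.rpow_ofNat, smul_eq_mul, one_pow, ENNReal.one_rpow] using h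

/-- The perimeter of a domain is controlled by its Skorokhod energy. -/
theorem mapPerimeter_sq_div_le {f : ℂ → ℂ} (hf : DifferentiableOn ℂ f (ball 0 1)) :
    mapPerimeter f ^ 2 / ENNReal.ofReal (4 * Real.pi) ≤
      ENNReal.ofReal (4 * Real.pi) * mapEnergy f := by
  have hpi : ENNReal.ofReal (4 * Real.pi) ≠ 0 := by simp [Real.pi_pos]
  obtain ⟨a, ha, ha'⟩ := exists_hasSum_pow_deriv hf
  rw [← ENNReal.div_le_iff' hpi ENNReal.ofReal_ne_top]
  refine le_iInf₂ fun u hu => le_iInf₂ fun v hv => ?_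
  rw [ENNReal.div_le_iff' hpi ENNReal.ofReal_ne_top]
  set E := (1 / 2) * ((ENNReal.ofReal (2 * Real.pi))⁻¹ *
        ∫⁻ t in Ioc 0 (2 * Real.pi), ‖v t‖ₑ ^ 2) with hE
  have hd := (hf.deriv isOpen_ball).continuousOn
  have hH : hardyNorm 1 (deriv f) ≤ (4 * E) ^ (1 / 2 : ℝ) := by
    refine iSup₂_le fun r hr => ?_
    simp only [ENNReal.rpow_one, div_one]
    refine (circle_mean_le_sqrt
      (continuous_comp_circleMap hd hr.1 hr.2).enorm.measurable).trans ?_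
    refine ENNReal.rpow_le_rpow ?_ (by norm_num)
    rw [circle_mean_sq_eq_tsum hd hr.1 hr.2 ha']
    refine le_trans (ENNReal.tsum_le_tsum fun n => ?_)
      (hu.tsum_enorm_sq_le hf.continuousOn hv ha)
    refine mul_le_of_le_one_right' (pow_le_one₀ zero_le ?_)
    exact ENNReal.ofReal_le_one.2 hr.2.le
  have hH2 : hardyNorm 1 (deriv f) ^ 2 ≤ 4 * E := by
    calc _ ≤ ((4 * E) ^ (1 / 2 : ℝ)) ^ 2 := by gcongr
      _ = _ := by rw [← ENNReal.rpow_natCast, ← ENNReal.rpow_mul]; norm_num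
  calc mapPerimeter f ^ 2 / ENNReal.ofReal (4 * Real.pi)
      = ENNReal.ofReal Real.pi * hardyNorm 1 (deriv f) ^ 2 := by
        rw [mapPerimeter, mul_pow, ENNReal.mul_div_right_comm,
          ← ENNReal.ofReal_pow (by positivity), ← ENNReal.ofReal_div_of_pos (by positivity)]
        congr 2
        field_simp
        ring
    _ ≤ ENNReal.ofReal Real.pi * (4 * E) := by gcongr
    _ = ENNReal.ofReal (4 * Real.pi) * E := by
        rw [ENNReal.ofReal_mul (by norm_num), ENNReal.ofReal_ofNat]; ring

/-! ### Lengths and Hausdorff measure of curves -/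

/-- The length of a continuously differentiable curve is at most the integral of its speed. -/
theorem eVariationOn_Icc_le_lintegral_enorm_deriv {E : Type*} [NormedAddCommGroup E]
    [NormedSpace ℝ E] [CompleteSpace E] {g g' : ℝ → E}
    (hg : ∀ t, HasDerivAt g (g' t) t) (hg' : Continuous g') (a b : ℝ) :
    eVariationOn g (Icc a b) ≤ ∫⁻ t in Ioc a b, ‖g' t‖ₑ := by
  refine iSup_le ?_
  rintro ⟨n, u, hu, hmem⟩
  have hstep : ∀ x y, x ≤ y → edist (g y) (g x) ≤ ∫⁻ t in Ioc x y, ‖g' t‖ₑ := by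
    intro x y hxy
    rw [edist_eq_enorm_sub, ← intervalIntegral.integral_eq_sub_of_hasDerivAt (fun t _ => hg t)
      (hg'.intervalIntegrable _ _), intervalIntegral.integral_of_le hxy]
    exact enorm_integral_le_lintegral_enorm _
  have hsum : ∀ n, ∑ i ∈ Finset.range n, edist (g (u (i + 1))) (g (u i)) ≤
      ∫⁻ t in Ioc (u 0) (u n), ‖g' t‖ₑ := by
    intro n
    induction n with
    | zero => simp
    | succ n ih =>
      rw [Finset.sum_range_succ, ← Ioc_union_Ioc_eq_Ioc (hu n.zero_le) (hu n.le_succ),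
        lintegral_union measurableSet_Ioc (Ioc_disjoint_Ioc_of_le le_rfl)]
      exact add_le_add ih (hstep _ _ (hu n.le_succ))
  exact (hsum n).trans (lintegral_mono_set (Ioc_subset_Ioc (hmem 0).1 (hmem n).2))

/-- The one-dimensional Hausdorff measure of a curve is at most its length. -/
theorem ContinuousOn.hausdorffMeasure_one_image_Icc_le {X : Type*} [MetricSpace X]
    [MeasurableSpace X] [BorelSpace X] {γ : ℝ → X} {a b : ℝ} (hab : a ≤ b)
    (hγ : ContinuousOn γ (Icc a b)) :
    Measure.hausdorffMeasure 1 (γ '' Icc a b) ≤ eVariationOn γ (Icc a b) := by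
  -- Cover the curve by the images of `N` equal subintervals: their diameters tend to `0` by uniform
  -- continuity, and each is at most the variation on its piece, which add up to the total
  -- variation.
  set p : ℕ → ℕ → ℝ := fun N i => a + (b - a) / N * i with hp
  have hba : 0 ≤ b - a := sub_nonneg.2 hab
  have hmono : ∀ N, Monotone (p N) := fun N i j hij => by
    simp only [hp]
    gcongr
  have hp0 : ∀ N, p N 0 = a := fun N => by simp [hp]
  have hpN : ∀ N, N ≠ 0 → p N N = b := fun N hN => by
    have : (N : ℝ) ≠ 0 := by exact_mod_cast hN
    simp only [hp]; field_simp; ring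
  have hsub : ∀ N i, i < N → Icc (p N i) (p N (i + 1)) ⊆ Icc a b := fun N i hi => by
    rw [← hp0 N, ← hpN N (by omega)]
    exact Icc_subset_Icc (hmono N i.zero_le) (hmono N hi)
  set t : (N : ℕ) → Fin N → Set X := fun N i => γ '' Icc (p N i) (p N (i + 1)) with ht
  have hr : Tendsto (fun N => ⨆ i, ediam (t N i)) atTop (𝓝 0) := by
    rw [ENNReal.tendsto_nhds_zero]
    intro ε hε
    have huc := isCompact_Icc.uniformContinuousOn_of_continuous hγ
    rw [EMetric.uniformContinuousOn_iff] at huc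
    obtain ⟨δ, hδ, h⟩ := huc ε hε
    have hlim : Tendsto (fun N : ℕ => ENNReal.ofReal ((b - a) / N)) atTop (𝓝 0) := by
      have := ENNReal.continuous_ofReal.tendsto 0 |>.comp
        (tendsto_const_div_atTop_nhds_zero_nat (b - a))
      simpa [Function.comp_def] using this
    filter_upwards [hlim.eventually_lt_const hδ] with N hN
    refine iSup_le fun i => ediam_le ?_
    rintro _ ⟨x, hx, rfl⟩ _ ⟨y, hy, rfl⟩
    refine (h (hsub N i i.2 hx) (hsub N i i.2 hy) (lt_of_le_of_lt ?_ hN)).le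
    rw [edist_dist]
    refine ENNReal.ofReal_le_ofReal ((Real.dist_le_of_mem_Icc hx hy).trans (le_of_eq ?_))
    simp only [hp]; push_cast; ring
  refine (Measure.hausdorffMeasure_le_liminf_sum 1 _ _ hr t
    (Eventually.of_forall fun N i => le_iSup (fun i => ediam (t N i)) i) ?_).trans ?_
  · filter_upwards [eventually_gt_atTop 0] with N hN
    rintro _ ⟨x, hx, rfl⟩
    have hcover : ∀ n, x ∈ Icc (p N 0) (p N (n + 1)) →
        ∃ i < n + 1, x ∈ Icc (p N i) (p N (i + 1)) := by
      intro n hn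
      induction n with
      | zero => exact ⟨0, one_pos, hn⟩
      | succ n ih =>
        rcases le_total x (p N (n + 1)) with h | h
        · obtain ⟨i, hi, hx⟩ := ih ⟨hn.1, h⟩
          exact ⟨i, by omega, hx⟩
        · exact ⟨n + 1, by omega, h, hn.2⟩
    obtain ⟨n, rfl⟩ := Nat.exists_eq_succ_of_ne_zero hN.ne'
    obtain ⟨i, hi, hxi⟩ := hcover n (by rwa [hp0, hpN _ n.succ_ne_zero])
    exact mem_iUnion.2 ⟨⟨i, hi⟩, mem_image_of_mem γ hxi⟩
  · refine (liminf_le_liminf (v := fun _ => eVariationOn γ (Icc a b)) ?_).trans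
      (le_of_eq (liminf_const _))
    filter_upwards [eventually_gt_atTop 0] with N hN
    have h := eVariationOn.sum' γ (hmono N) (n := N)
    rw [hp0, hpN N hN.ne', ← Fin.sum_univ_eq_sum_range
      (fun i => eVariationOn γ (Icc (p N i) (p N (i + 1))))] at h
    rw [← h]
    refine Finset.sum_le_sum fun i _ => ?_
    rw [ENNReal.rpow_one]
    refine ediam_le ?_
    rintro _ ⟨x, hx, rfl⟩ _ ⟨y, hy, rfl⟩
    exact eVariationOn.edist_le γ hx hy

/-! ### The boundary curve of a domain of finite energy -/

/-- `2xy ≤ x² + y²` with `x = (n+1)|aₙ₊₁|` and `y = 1/(n+1)`, both square summable. -/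
theorem summable_norm_of_tsum_enorm_sq_ne_top {a : ℕ → ℂ}
    (h : ∑' n : ℕ, ‖((n : ℂ) + 1) * a (n + 1)‖ₑ ^ 2 ≠ ⊤) : Summable fun n => ‖a n‖ := by
  rw [← summable_nat_add_iff 1]
  have h1 : Summable fun n : ℕ => (((n : ℝ) + 1) * ‖a (n + 1)‖) ^ 2 := by
    have := ENNReal.summable_toReal h
    refine this.congr fun n => ?_
    rw [ENNReal.toReal_pow, toReal_enorm, norm_mul]
    congr 2
    exact_mod_cast Complex.norm_natCast (n + 1)
  have h2 : Summable fun n : ℕ => (1 / ((n : ℝ) + 1)) ^ 2 := by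
    have := (summable_nat_add_iff 1).2 (Real.summable_one_div_nat_pow.2 one_lt_two)
    refine this.congr fun n => ?_
    push_cast
    rw [div_pow, one_pow]
  refine Summable.of_nonneg_of_le (fun n => norm_nonneg _) (fun n => ?_) (h1.add h2)
  have hn : (0 : ℝ) < n + 1 := by positivity
  have := two_mul_le_add_sq (((n : ℝ) + 1) * ‖a (n + 1)‖) (1 / ((n : ℝ) + 1))
  have e : 2 * (((n : ℝ) + 1) * ‖a (n + 1)‖) * (1 / ((n : ℝ) + 1)) = 2 * ‖a (n + 1)‖ := by
    field_simp
  linarith [norm_nonneg (a (n + 1))]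

theorem lintegral_enorm_deriv_le_mapPerimeter (f : ℂ → ℂ) {r : ℝ} (hr : r ∈ Ico (0 : ℝ) 1) :
    ∫⁻ t in Ioc 0 (2 * Real.pi), ‖deriv f (circleMap 0 r t)‖ₑ ≤ mapPerimeter f := by
  have hpi : ENNReal.ofReal (2 * Real.pi) ≠ 0 := by simp [Real.pi_pos]
  have h := le_iSup₂ (f := fun (r : ℝ) (_ : r ∈ Ico (0 : ℝ) 1) =>
      ((ENNReal.ofReal (2 * Real.pi))⁻¹ *
        ∫⁻ θ in Ioc 0 (2 * Real.pi), ‖deriv f (circleMap 0 r θ)‖ₑ ^ (1 : ℝ)) ^ (1 / (1 : ℝ))) r hr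
  simp only [ENNReal.rpow_one, div_one] at h
  rw [ENNReal.inv_mul_le_iff hpi ENNReal.ofReal_ne_top] at h
  simpa only [mapPerimeter, hardyNorm, ENNReal.rpow_one, div_one] using h

/-- The speed of the curve is `r |f'|`, at most `|f'|` because `r < 1`. -/
theorem eVariationOn_comp_circleMap_le_mapPerimeter {f : ℂ → ℂ}
    (hf : DifferentiableOn ℂ f (ball 0 1)) {r : ℝ} (hr : r ∈ Ico (0 : ℝ) 1) :
    eVariationOn (fun t => f (circleMap 0 r t)) (Icc 0 (2 * Real.pi)) ≤ mapPerimeter f := by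
  have hd := (hf.deriv isOpen_ball).continuousOn
  refine (eVariationOn_Icc_le_lintegral_enorm_deriv
    (g' := fun t => deriv f (circleMap 0 r t) * (circleMap 0 r t * Complex.I)) (fun t => ?_) ?_
    _ _).trans (le_trans (lintegral_mono fun t => ?_)
      (lintegral_enorm_deriv_le_mapPerimeter f hr))
  · exact (hf.differentiableAt (isOpen_ball.mem_nhds
      (circleMap_mem_unitBall hr.1 hr.2 t))).hasDerivAt.comp t (hasDerivAt_circleMap 0 r t)
  · have := continuous_comp_circleMap hd hr.1 hr.2
    fun_prop
  · simp only
    rw [enorm_mul]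
    refine mul_le_of_le_one_right' ?_
    rw [← ofReal_norm, ENNReal.ofReal_le_one]
    simpa [abs_of_nonneg hr.1] using hr.2.le

/-- If the Taylor series of a univalent map is absolutely summable on the closed disc, then the
boundary of the image is a curve whose length is at most the perimeter. -/
theorem IsUnivalentOnto.hausdorffMeasure_frontier_le {f : ℂ → ℂ} {U : Set ℂ} {a : ℕ → ℂ}
    (hf : IsUnivalentOnto f U) (hUo : IsOpen U)
    (ha : ∀ z ∈ ball (0 : ℂ) 1, HasSum (fun n => a n * z ^ n) (f z))
    (hs : Summable fun n => ‖a n‖) :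
    Measure.hausdorffMeasure 1 (frontier U) ≤ mapPerimeter f := by
  set G : ℂ → ℂ := fun z => ∑' n, a n * z ^ n with hG
  have hGc : ContinuousOn G (closedBall 0 1) := by
    refine continuousOn_tsum (fun n => by fun_prop) hs fun n z hz => ?_
    rw [norm_mul, norm_pow]
    exact mul_le_of_le_one_right (norm_nonneg _)
      (pow_le_one₀ (norm_nonneg _) (by simpa using hz))
  have hGf : ∀ z ∈ ball (0 : ℂ) 1, G z = f z := fun z hz => (ha z hz).tsum_eq
  set γ : ℝ → ℂ := fun t => G (circleMap 0 1 t) with hγ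
  have hγc : Continuous γ := hGc.comp_continuous (continuous_circleMap 0 1) fun t => by simp
  -- The compact set `G '' closedBall 0 1` contains the closure of `U`. A frontier point is not in
  -- the open set `U`, so its preimages have modulus one.
  have hfr : frontier U ⊆ γ '' Icc 0 (2 * Real.pi) := by
    rw [hUo.frontier_eq]
    rintro w ⟨hw, hwU⟩
    have hcl : closure U ⊆ G '' closedBall 0 1 := by
      refine closure_minimal ?_ ((isCompact_closedBall 0 1).image_of_continuousOn hGc).isClosed
      rw [← hf.image_eq]
      rintro _ ⟨z, hz, rfl⟩
      exact ⟨z, ball_subset_closedBall hz, hGf z hz⟩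
    obtain ⟨z, hz, rfl⟩ := hcl hw
    have hz1 : ‖z‖ = 1 := by
      refine le_antisymm (by simpa using hz) (not_lt.1 fun hlt => hwU ?_)
      have hzb : z ∈ ball (0 : ℂ) 1 := by simpa using hlt
      rw [hGf z hzb, ← hf.image_eq]
      exact mem_image_of_mem f hzb
    have : z ∈ circleMap 0 1 '' Ioc 0 (2 * Real.pi) := by
      rw [image_circleMap_Ioc]
      simpa using hz1
    obtain ⟨t, ht, rfl⟩ := this
    exact ⟨t, Ioc_subset_Icc_self ht, rfl⟩
  refine (measure_mono hfr).trans
    ((hγc.continuousOn.hausdorffMeasure_one_image_Icc_le Real.two_pi_pos.le).trans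
      (not_lt.1 fun hlt => ?_))
  have htend : ∀ t ∈ Icc 0 (2 * Real.pi),
      Tendsto (fun r : ℝ => f (circleMap 0 r t)) (𝓝[<] 1) (𝓝 (γ t)) := by
    intro t _
    have h1 : Tendsto (fun r : ℝ => circleMap 0 r t) (𝓝[<] 1)
        (𝓝[closedBall 0 1] circleMap 0 1 t) := by
      refine tendsto_nhdsWithin_iff.2 ⟨?_, ?_⟩
      · have : Continuous fun r : ℝ => circleMap 0 r t := by unfold circleMap; fun_prop
        exact (this.tendsto 1).mono_left nhdsWithin_le_nhds
      · filter_upwards [Ioo_mem_nhdsLT (zero_lt_one' ℝ)] with r hr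
        exact ball_subset_closedBall (circleMap_mem_unitBall hr.1.le hr.2 t)
    refine ((hGc (circleMap 0 1 t) (by simp)).tendsto.comp h1).congr' ?_
    filter_upwards [Ioo_mem_nhdsLT (zero_lt_one' ℝ)] with r hr
    exact hGf _ (circleMap_mem_unitBall hr.1.le hr.2 t)
  -- Variation is lower semicontinuous under pointwise convergence: if `γ` were longer than the
  -- perimeter, so would be the image of some circle of radius `r < 1`.
  obtain ⟨r, hr, hr'⟩ := ((eVariationOn.lowerSemicontinuous_aux htend hlt).and
    (Ioo_mem_nhdsLT (zero_lt_one' ℝ))).exists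
  exact hr.not_ge (eVariationOn_comp_circleMap_le_mapPerimeter hf.differentiableOn
    ⟨hr'.1.le, hr'.2⟩)

/-! ### The main theorem -/

theorem proposition1p1 (U : Set ℂ) (hUo : IsOpen U) (hUc : IsSimplyConnected U)
    (h0 : (0 : ℂ) ∈ U) :
    (skorokhodEnergy U < ⊤ →
      domainPerimeter U < ⊤ ∧ volume U < ⊤ ∧
        MeasureTheory.Measure.hausdorffMeasure 1 (frontier U) ≤ domainPerimeter U) ∧
    volume U ≤ domainPerimeter U ^ 2 / ENNReal.ofReal (4 * Real.pi) ∧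
    domainPerimeter U ^ 2 / ENNReal.ofReal (4 * Real.pi) ≤
      ENNReal.ofReal (4 * Real.pi) * skorokhodEnergy U ∧
    volume U ≤ ENNReal.ofReal (4 * Real.pi) * skorokhodEnergy U := by
  have hpi : ENNReal.ofReal (4 * Real.pi) ≠ 0 := by simp [Real.pi_pos]
  by_cases hex : ∃ f, IsUnivalentOnto f U
  · obtain ⟨f, hf⟩ := hex
    rw [skorokhodEnergy_eq hf, domainPerimeter_eq hf]
    have h1 := hf.volume_le_mapPerimeter_sq
    have h2 := mapPerimeter_sq_div_le hf.differentiableOn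
    refine ⟨fun hfin => ⟨?_, ?_, ?_⟩, h1, h2, h1.trans h2⟩
    · refine lt_top_iff_ne_top.2 fun htop => ?_
      rw [htop, ENNReal.top_pow two_ne_zero, ENNReal.top_div_of_ne_top ENNReal.ofReal_ne_top] at h2
      exact (ENNReal.mul_lt_top ENNReal.ofReal_lt_top hfin).not_ge h2
    · exact (h1.trans h2).trans_lt (ENNReal.mul_lt_top ENNReal.ofReal_lt_top hfin)
    · obtain ⟨a, ha, -⟩ := exists_hasSum_pow_deriv hf.differentiableOn
      simp only [mapEnergy, kineticEnergy, iInf_lt_iff] at hfin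
      obtain ⟨u, hu, v, hv, hfin⟩ := hfin
      refine hf.hausdorffMeasure_frontier_le hUo ha (summable_norm_of_tsum_enorm_sq_ne_top
        (ne_top_of_le_ne_top ?_ (hu.tsum_enorm_sq_le hf.differentiableOn.continuousOn hv ha)))
      exact ENNReal.mul_ne_top (by simp) hfin.ne
  -- With no univalent map, as for the whole plane, both infima are over an empty family, hence
  -- infinite, and every claim is trivial.
  · have hS : skorokhodEnergy U = ⊤ := by
      refine iInf₂_eq_top.2 fun f hf => (hex ⟨f, hf⟩).elim
    have hP : domainPerimeter U = ⊤ := by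
      refine iInf₂_eq_top.2 fun f hf => (hex ⟨f, hf⟩).elim
    rw [hS, hP, ENNReal.mul_top hpi, ENNReal.top_pow two_ne_zero,
      ENNReal.top_div_of_ne_top ENNReal.ofReal_ne_top]
    simp
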